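/- Let $\mathbb K$ be a field and let $A(n,m)$ be the root system with even roots $\epsilon_i-\epsilon_j$, $\delta_i-\delta_j$ $(i\ne j)$ and odd roots $\pm(\epsilon_i-\delta_j)$, where $\epsilon_1,\dots,\epsilon_n,\delta_1,\dots,\delta_m$ is the standard basis of $\mathbb Z^{n+m}$; forgetting parities, it is the root system $A_{n+m-1}$. Let $\Pi=\{\alpha_i\}_{i\in\Gamma}$ be a simple system of $A(n,m)$, let $\Gamma_{col}$ be its Dynkin diagram (distinct $i,j$ are joined iff $\alpha_i,\alpha_j$ are not orthogonal in $A_{n+m-1}$), coloured by $p(i)=p(\alpha_i)\in\mathbb Z_2$, and let $\Omega$ be an orientation of it. For a sink or source $i$, let $(s_i\Gamma_{col},s_i\Omega)$ be obtained by reversing all arrows at $i$ and, if $p(i)=1$, changing the colours of all neighbours of $i$. Let $w_0=s_{i_1}\cdots s_{i_l}$ be a reduced expression, in the simple reflections of $A_{n+m-1}$, for the longest element of its Weyl group, adapted to $\Omega$: each $i_k$ is a sink of $s_{i_{k-1}}\cdots s_{i_1}\Omega$. A super-representation $X$ of a coloured quiver consists of finite-dimensional $\mathbb Z_2$-graded spaces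 $X(i)$ and, for every arrow $i\to j$, a homogeneous linear map $X(i)\to X(j)$ of degree $p(i)+p(j)$. A morphism is a family of homogeneous linear maps $X(i)\to Y(i)$, each of degree $0$ or $1$, commuting with the maps of the arrows. $X$ is indecomposable if it is nonzero and not the direct sum of two nonzero (graded) subrepresentations. Let $P$ be the parity change. Let $\mathbb S_i^p$ be the super-representation that is one-dimensional of parity $p$ at $i$ and zero elsewhere. Let $i$ be a source of a coloured quiver $(\Gamma'_{col},\Omega')$ with colouring $p$. The super reflection functor $\widetilde S_i^-$, from super-representations of $(\Gamma'_{col},\Omega')$ to those of $(s_i\Gamma'_{col},s_i\Omega')$, is given by $$\widetilde S_i^-X(i)=\operatorname{coker}\Bigl(X(i)\to\bigoplus_{i\to k}P^{p(i)+p(k)}X(k)\Bigr),\qquad \widetilde S_i^-X(j)=P^{p(i)}X(j)\ \text{ for the neighbours } j \text{ of } i,$$ and $\widetilde S_i^-X(j)=X(j)$ for all other $j$; the maps of the arrows $k\to i$ of $s_i\Omega'$ are the canonical maps into the cokernel, and all other maps are, up to parity change, those of $X$. **Theorem.** Let $\alpha$ be a positive root for $\Pi$. There is exactly one $j\in\{1,\dots,l\}$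 with $\alpha=s_{i_1}\cdots s_{i_{j-1}}\alpha_{i_j}$ (reflections taken in $A_{n+m-1}$). Put $$X_\alpha=\widetilde S_{i_1}^-\cdots\widetilde S_{i_{j-1}}^-\bigl(\mathbb S_{i_j}^{p_j}\bigr),$$ where $p_j$ is the colour of $i_j$ in $s_{i_{j-1}}\cdots s_{i_1}\Gamma_{col}$. Then: 1. $X_\alpha$ is an indecomposable super-representation of $(\Gamma_{col},\Omega)$; 2. its dimension vector is $\alpha$, that is, $\sum_{i}\dim X_\alpha(i)\,\alpha_i=\alpha$; 3. it has the same parity as $\alpha$: every $X_\alpha(i)$ is purely even or purely odd, and $\sum_i p(X_\alpha(i))=p(\alpha)$, where the zero space has parity $0$; 4. every indecomposable super-representation of $(\Gamma_{col},\Omega)$ of dimension vector $\alpha$ is isomorphic to $X_\alpha$. -/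

import Mathlib

universe u v w

/-! ### The root system `A(n,m)` -/

/-- The functional `ε_i`, as an element of the free lattice on `ε_1, …, ε_n, δ_1, …, δ_m`.
Under `ε_i ↦ e_i`, `δ_j ↦ e_{n+j}` this lattice is the lattice `ℤ^{n+m}` that contains the root
system `A_{n+m-1}`. -/
def epsVec {n m : ℕ} (i : Fin n) : Fin n ⊕ Fin m → ℤ := Pi.single (Sum.inl i) 1

/-- The functional `δ_j`. -/
def delVec {n m : ℕ} (j : Fin m) : Fin n ⊕ Fin m → ℤ := Pi.single (Sum.inr j) 1

/-- The even roots `ε_i - ε_j`, `δ_i - δ_j` (`i ≠ j`). -/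
def IsEvenRoot {n m : ℕ} (α : Fin n ⊕ Fin m → ℤ) : Prop :=
  (∃ i j : Fin n, i ≠ j ∧ α = epsVec i - epsVec j) ∨
    (∃ i j : Fin m, i ≠ j ∧ α = delVec i - delVec j)

/-- The odd roots `± (ε_i - δ_j)`. -/
def IsOddRoot {n m : ℕ} (α : Fin n ⊕ Fin m → ℤ) : Prop :=
  ∃ (i : Fin n) (j : Fin m), α = epsVec i - delVec j ∨ α = -(epsVec i - delVec j)

/-- The roots of `A(n,m)`. -/
def IsSuperRoot {n m : ℕ} (α : Fin n ⊕ Fin m → ℤ) : Prop := IsEvenRoot α ∨ IsOddRoot α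

open Classical in
/-- The parity function on the roots of `A(n,m)`. -/
noncomputable def rootParity {n m : ℕ} (α : Fin n ⊕ Fin m → ℤ) : ZMod 2 :=
  if IsOddRoot α then 1 else 0

/-- A simple system of `A(n,m)`, with simple roots indexed by the vertices `ι` of its
Dynkin diagram: linearly independent roots such that every root is a combination of them with
all coefficients nonnegative integers or all coefficients nonpositive integers. -/
structure SimpleSystem (n m : ℕ) (ι : Type) [Fintype ι] where
  root : ι → (Fin n ⊕ Fin m → ℤ)
  isRoot : ∀ i, IsSuperRoot (root i)
  linearIndependent : LinearIndependent ℤ root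
  pos_or_neg : ∀ α : Fin n ⊕ Fin m → ℤ, IsSuperRoot α →
    (∃ c : ι → ℕ, α = ∑ i, c i • root i) ∨ (∃ c : ι → ℕ, -α = ∑ i, c i • root i)

namespace SimpleSystem

variable {n m : ℕ} {ι : Type} [Fintype ι]

/-- The positive roots with respect to a simple system. -/
def IsPositiveRoot (S : SimpleSystem n m ι) (α : Fin n ⊕ Fin m → ℤ) : Prop :=
  IsSuperRoot α ∧ ∃ c : ι → ℕ, α = ∑ i, c i • S.root i

/-- The underlying (uncoloured) Dynkin diagram, computed in `A_{n+m-1}`: two simple roots are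
joined when they are not orthogonal. -/
def dynkinGraph (S : SimpleSystem n m ι) : SimpleGraph ι where
  Adj i j := i ≠ j ∧ S.root i ⬝ᵥ S.root j ≠ 0
  symm := ⟨fun _ _ h => ⟨h.1.symm, by rw [dotProduct_comm]; exact h.2⟩⟩
  loopless := ⟨fun _ h => h.1 rfl⟩

/-- The simple reflection `s_i` of the root system `A_{n+m-1}`; every root has square length 2. -/
def simpleReflection (S : SimpleSystem n m ι) (i : ι) :
    Module.End ℤ (Fin n ⊕ Fin m → ℤ) where
  toFun x := x - (x ⬝ᵥ S.root i) • S.root i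
  map_add' x y := by rw [add_dotProduct, add_smul]; abel
  map_smul' c x := by
    rw [smul_dotProduct, smul_eq_mul, mul_smul, smul_sub, RingHom.id_apply]

/-- The element `s_{i_1} s_{i_2} ⋯ s_{i_l}` of the Weyl group of `A_{n+m-1}`. -/
def wordProd (S : SimpleSystem n m ι) (l : List ι) : Module.End ℤ (Fin n ⊕ Fin m → ℤ) :=
  (l.map S.simpleReflection).prod

/-- A word is reduced if no shorter word in the simple reflections has the same product. -/
def IsReduced (S : SimpleSystem n m ι) (l : List ι) : Prop :=
  ∀ l' : List ι, S.wordProd l' = S.wordProd l → l.length ≤ l'.length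

/-- Reduced expressions for the longest element `w₀`. -/
def IsReducedLongest (S : SimpleSystem n m ι) (l : List ι) : Prop :=
  S.IsReduced l ∧ ∀ l' : List ι, S.IsReduced l' → l'.length ≤ l.length

/-- The root `s_{i_1} ⋯ s_{i_{j-1}} α_{i_j}`; positions in the list are counted from `0`. -/
def wordRoot (S : SimpleSystem n m ι) (l : List ι) (j : Fin l.length) : Fin n ⊕ Fin m → ℤ :=
  S.wordProd (l.take j) (S.root (l.get j))

end SimpleSystem

/-! ### Coloured quivers -/

/-- A `ℤ/2`-coloured quiver without multiple arrows. -/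
structure ColouredQuiver (ι : Type) where
  arrow : ι → ι → Prop
  colour : ι → ZMod 2

/-- `Ω` is an orientation of the graph `G`: each edge receives exactly one of its
two directions. -/
def IsOrientation {ι : Type} (G : SimpleGraph ι) (Ω : ι → ι → Prop) : Prop :=
  (∀ i j, G.Adj i j ↔ Ω i j ∨ Ω j i) ∧ ∀ i j, Ω i j → ¬ Ω j i

/-- The quiver `(Γ_col, Ω)`: the Dynkin diagram with odd simple roots coloured by `1`, even ones
by `0`, and with arrows given by `Ω`. -/
noncomputable def SimpleSystem.quiver {n m : ℕ} {ι : Type} [Fintype ι] (S : SimpleSystem n m ι)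
    (Ω : ι → ι → Prop) : ColouredQuiver ι where
  arrow := Ω
  colour i := rootParity (S.root i)

namespace ColouredQuiver

variable {ι : Type}

def IsSink (Q : ColouredQuiver ι) (i : ι) : Prop := ∀ j, ¬ Q.arrow i j

def IsSource (Q : ColouredQuiver ι) (i : ι) : Prop := ∀ j, ¬ Q.arrow j i

open Classical in
/-- The coloured quiver `(s_i Γ_col, s_i Ω)`: all arrows at `i` are reversed and, if `i` has
colour `1`, the colours of all neighbours of `i` are changed. -/
noncomputable def reflect (Q : ColouredQuiver ι) (i : ι) : ColouredQuiver ι where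
  arrow j k := if j = i ∨ k = i then Q.arrow k j else Q.arrow j k
  colour j := if Q.colour i = 1 ∧ (Q.arrow j i ∨ Q.arrow i j) then Q.colour j + 1 else Q.colour j

/-- A word `i_1 i_2 ⋯ i_l` is adapted if each `i_k` is a sink of `s_{i_{k-1}} ⋯ s_{i_1} Ω`. -/
def IsAdapted : ColouredQuiver ι → List ι → Prop
  | _, [] => True
  | Q, i :: l => Q.IsSink i ∧ (Q.reflect i).IsAdapted l

theorem IsAdapted.take {Q : ColouredQuiver ι} {l : List ι} (h : Q.IsAdapted l) (j : ℕ) :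
    Q.IsAdapted (l.take j) := by
  induction l generalizing Q j with
  | nil => simp [IsAdapted]
  | cons i l ih =>
    cases j with
    | zero => simp [IsAdapted]
    | succ j => exact ⟨h.1, ih h.2 j⟩

theorem reflect_arrow_left {Q : ColouredQuiver ι} {i k : ι} :
    (Q.reflect i).arrow i k ↔ Q.arrow k i := by
  simp [reflect]

theorem reflect_arrow_of_ne {Q : ColouredQuiver ι} {i j k : ι} (hj : j ≠ i) (hk : k ≠ i) :
    (Q.reflect i).arrow j k ↔ Q.arrow j k := by
  simp [reflect, hj, hk]

theorem IsSink.isSource_reflect {Q : ColouredQuiver ι} {i : ι} (hi : Q.IsSink i) :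
    (Q.reflect i).IsSource i := by
  intro j
  simpa [reflect] using hi j

open Classical in
theorem IsSink.reflect_colour {Q : ColouredQuiver ι} {i : ι} (hi : Q.IsSink i) (j : ι) :
    (Q.reflect i).colour j = Q.colour j + if Q.arrow j i then Q.colour i else 0 := by
  have h2 : ∀ x : ZMod 2, x = 0 ∨ x = 1 := by decide
  have := hi j
  rcases h2 (Q.colour i) with h | h <;> by_cases hj : Q.arrow j i <;> simp [reflect, h, hj, this]

/-- Reflecting twice at a sink gives back the coloured quiver. -/
theorem IsSink.reflect_reflect {Q : ColouredQuiver ι} {i : ι} (hi : Q.IsSink i) :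
    (Q.reflect i).reflect i = Q := by
  classical
  have h2 : ∀ x : ZMod 2, x + 1 + 1 = x := by decide
  have hii : ¬ Q.arrow i i := hi i
  have ha : ((Q.reflect i).reflect i).arrow = Q.arrow := by
    funext j k
    by_cases hj : j = i <;> by_cases hk : k = i <;> simp [reflect, hj, hk]
  have hc : ((Q.reflect i).reflect i).colour = Q.colour := by
    funext j
    have := hi j
    by_cases h : Q.colour i = 1 <;> by_cases hj : Q.arrow j i <;>
      simp [reflect, h, hj, hii, this, h2]
  have hext : ∀ A B : ColouredQuiver ι, A.arrow = B.arrow → A.colour = B.colour → A = B := by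
    rintro ⟨_, _⟩ ⟨_, _⟩ rfl rfl
    rfl
  exact hext _ _ ha hc

end ColouredQuiver

/-! ### Super vector spaces -/

/-- A finite dimensional `ℤ/2`-graded vector space over `K`. -/
structure SuperSpace (K : Type u) [Field K] where
  carrier : Type v
  [addCommGroup : AddCommGroup carrier]
  [module : Module K carrier]
  [finiteDimensional : FiniteDimensional K carrier]
  grade : ZMod 2 → Submodule K carrier
  isCompl : IsCompl (grade 0) (grade 1)

namespace SuperSpace

variable {K : Type u} [Field K]

instance : CoeSort (SuperSpace.{u, v} K) (Type v) := ⟨SuperSpace.carrier⟩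

attribute [instance] SuperSpace.addCommGroup SuperSpace.module SuperSpace.finiteDimensional

/-- `f` is homogeneous of degree `d`. -/
def HasDegree {V : SuperSpace.{u, v} K} {W : SuperSpace.{u, w} K} (f : V →ₗ[K] W)
    (d : ZMod 2) : Prop :=
  ∀ p, ∀ x ∈ V.grade p, f x ∈ W.grade (p + d)

theorem isCompl_add (V : SuperSpace.{u, v} K) (d : ZMod 2) :
    IsCompl (V.grade d) (V.grade (d + 1)) := by
  have h2 : ∀ x : ZMod 2, x = 0 ∨ x = 1 := by decide
  rcases h2 d with rfl | rfl
  · simpa using V.isCompl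
  · have h : (1 : ZMod 2) + 1 = 0 := by decide
    rw [h]
    exact V.isCompl.symm

/-- The `d`-th power `P^d` of the parity change functor. Since the underlying space is not
changed, `P` is the identity on underlying linear maps. -/
def shift (d : ZMod 2) (V : SuperSpace.{u, v} K) : SuperSpace.{u, v} K where
  carrier := V
  grade p := V.grade (p + d)
  isCompl := by
    have h := V.isCompl_add d
    rwa [zero_add, add_comm 1 d]

/-- The identity map `V → P^d V`. -/
def shiftEquiv (d : ZMod 2) (V : SuperSpace.{u, v} K) : V ≃ₗ[K] V.shift d :=
  LinearEquiv.refl K V.carrier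

/-- The zero space. -/
def zero (K : Type u) [Field K] : SuperSpace.{u, v} K where
  carrier := PUnit
  grade _ := ⊤
  isCompl := ⟨by rw [disjoint_iff]; exact Subsingleton.elim _ _,
    by rw [codisjoint_iff]; exact Subsingleton.elim _ _⟩

/-- The one-dimensional space of parity `p`, that is `K^{1|0}` if `p = 0` and `K^{0|1}` if
`p = 1`. -/
def line (K : Type u) [Field K] (p : ZMod 2) : SuperSpace.{u, u} K where
  carrier := K
  grade q := if q = p then ⊤ else ⊥
  isCompl := by
    have h2 : ∀ x : ZMod 2, x = 0 ∨ x = 1 := by decide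
    rcases h2 p with rfl | rfl
    · simpa using isCompl_top_bot
    · simpa using isCompl_bot_top

/-- The direct sum of a finite family. -/
def directSum {κ : Type} [Finite κ] (V : κ → SuperSpace.{u, v} K) : SuperSpace.{u, v} K where
  carrier := ∀ k, V k
  grade p := Submodule.pi Set.univ fun k => (V k).grade p
  isCompl := by
    constructor
    · rw [Submodule.disjoint_def]
      intro x h0 h1
      funext k
      exact (Submodule.disjoint_def.1 (V k).isCompl.disjoint) _ (h0 k trivial) (h1 k trivial)
    · rw [codisjoint_iff, eq_top_iff]
      intro x _
      have hx : ∀ k, ∃ y ∈ (V k).grade 0, ∃ z ∈ (V k).grade 1, y + z = x k := fun k => by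
        have h := (V k).isCompl.sup_eq_top
        exact Submodule.mem_sup.1 (h ▸ Submodule.mem_top)
      choose y hy z hz hyz using hx
      exact Submodule.mem_sup.2 ⟨y, fun k _ => hy k, z, fun k _ => hz k, funext hyz⟩

open Classical in
/-- The inclusion of a summand. -/
noncomputable def incl {κ : Type} [Finite κ] (V : κ → SuperSpace.{u, v} K) (k : κ) :
    V k →ₗ[K] directSum V :=
  LinearMap.single K (fun k => (V k).carrier) k

theorem incl_mem {κ : Type} [Finite κ] (V : κ → SuperSpace.{u, v} K) (k : κ) {p : ZMod 2}
    {x : V k} (hx : x ∈ (V k).grade p) : incl V k x ∈ (directSum V).grade p := by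
  classical
  intro l _
  by_cases hl : l = k
  · subst hl
    have h1 : incl V l x l = x := Pi.single_eq_same (M := fun k => (V k).carrier) l x
    rw [h1]
    exact hx
  · have h0 : incl V k x l = 0 :=
      Pi.single_eq_of_ne (M := fun k => (V k).carrier) hl x
    rw [h0]
    exact Submodule.zero_mem _

/-- The cokernel of a homogeneous map of degree `0`, with the quotient grading. -/
def coker {V : SuperSpace.{u, v} K} {W : SuperSpace.{u, w} K} (f : V →ₗ[K] W)
    (hf : HasDegree f 0) : SuperSpace.{u, w} K where
  carrier := W ⧸ LinearMap.range f
  grade p := (W.grade p).map (LinearMap.range f).mkQ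
  isCompl := by
    constructor
    · rw [Submodule.disjoint_def]
      rintro _ ⟨a, ha, rfl⟩ ⟨b, hb, hab⟩
      obtain ⟨x, hx⟩ := (Submodule.Quotient.eq _).1 hab
      obtain ⟨y, hy, z, hz, rfl⟩ := Submodule.mem_sup.1
        (V.isCompl.sup_eq_top ▸ Submodule.mem_top : x ∈ V.grade 0 ⊔ V.grade 1)
      have hy' : f y ∈ W.grade 0 := by simpa using hf 0 y hy
      have hz' : f z ∈ W.grade 1 := by simpa using hf 1 z hz
      have key : a + f y = b - f z := by
        rw [map_add] at hx
        rw [eq_sub_iff_add_eq, add_assoc, hx]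
        abel
      have h0 := (Submodule.disjoint_def.1 W.isCompl.disjoint) (a + f y)
        (add_mem ha hy') (key ▸ sub_mem hb hz')
      refine (Submodule.Quotient.mk_eq_zero _).2 ⟨-y, ?_⟩
      rw [map_neg]
      exact (eq_neg_of_add_eq_zero_left h0).symm
    · rw [codisjoint_iff, ← Submodule.map_sup, W.isCompl.sup_eq_top, Submodule.map_top,
        Submodule.range_mkQ]

/-- The projection to the cokernel. -/
def cokerMk {V : SuperSpace.{u, v} K} {W : SuperSpace.{u, w} K} (f : V →ₗ[K] W)
    (hf : HasDegree f 0) : W →ₗ[K] coker f hf where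
  toFun x := Submodule.Quotient.mk x
  map_add' _ _ := rfl
  map_smul' _ _ := rfl

theorem cokerMk_mem {V : SuperSpace.{u, v} K} {W : SuperSpace.{u, w} K} (f : V →ₗ[K] W)
    (hf : HasDegree f 0) {p : ZMod 2} {x : W} (hx : x ∈ W.grade p) :
    cokerMk f hf x ∈ (coker f hf).grade p :=
  ⟨x, hx, rfl⟩

/-- Transport along an equality of super vector spaces. -/
def equivOfEq {V W : SuperSpace.{u, v} K} (h : V = W) : V ≃ₗ[K] W := by
  subst h
  exact LinearEquiv.refl K _

theorem equivOfEq_mem {V W : SuperSpace.{u, v} K} (h : V = W) {p : ZMod 2} {x : V}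
    (hx : x ∈ V.grade p) : equivOfEq h x ∈ W.grade p := by
  subst h
  exact hx

theorem equivOfEq_symm_mem {V W : SuperSpace.{u, v} K} (h : V = W) {p : ZMod 2} {x : W}
    (hx : x ∈ W.grade p) : (equivOfEq h).symm x ∈ V.grade p := by
  subst h
  exact hx

end SuperSpace

/-! ### Super-representations -/

/-- A super-representation of a coloured quiver: the map of an arrow `i → j` is homogeneous of
degree `p(i) + p(j)`. -/
structure SuperRep (K : Type u) [Field K] {ι : Type} (Q : ColouredQuiver ι) where
  space : ι → SuperSpace.{u, v} K
  map : ∀ {i j : ι}, Q.arrow i j → (space i →ₗ[K] space j)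
  hasDegree_map : ∀ {i j : ι} (e : Q.arrow i j),
    SuperSpace.HasDegree (map e) (Q.colour i + Q.colour j)

namespace SuperRep

variable {K : Type u} [Field K] {ι : Type} {Q : ColouredQuiver ι}

/-- A morphism of super-representations: homogeneous linear maps, of degree `0` or `1`,
that commute with the maps of all arrows. -/
structure Hom (X : SuperRep.{u, v} K Q) (Y : SuperRep.{u, w} K Q) where
  app : ∀ i, X.space i →ₗ[K] Y.space i
  homogeneous : ∀ i, ∃ d : ZMod 2, SuperSpace.HasDegree (app i) d
  comm : ∀ {i j : ι} (e : Q.arrow i j), app j ∘ₗ X.map e = Y.map e ∘ₗ app i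

/-- Isomorphism in the category of super-representations. -/
def Isomorphic (X : SuperRep.{u, v} K Q) (Y : SuperRep.{u, w} K Q) : Prop :=
  ∃ (f : Hom X Y) (g : Hom Y X),
    ∀ i, g.app i ∘ₗ f.app i = LinearMap.id ∧ f.app i ∘ₗ g.app i = LinearMap.id

/-- A (graded) subrepresentation. -/
structure SubRep (X : SuperRep.{u, v} K Q) where
  space : ∀ i, Submodule K (X.space i)
  graded : ∀ i, space i =
    (space i ⊓ (X.space i).grade 0) ⊔ (space i ⊓ (X.space i).grade 1)
  map_mem : ∀ {i j : ι} (e : Q.arrow i j), ∀ x ∈ space i, X.map e x ∈ space j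

/-- `X` is nonzero and is not the direct sum of two nonzero subrepresentations. -/
def IsIndecomposable (X : SuperRep.{u, v} K Q) : Prop :=
  (∃ i, Nontrivial (X.space i)) ∧
    ∀ U W : SubRep X, (∀ i, IsCompl (U.space i) (W.space i)) →
      (∀ i, U.space i = ⊥) ∨ (∀ i, W.space i = ⊥)

/-- The dimension vector. -/
noncomputable def dimVec (X : SuperRep.{u, v} K Q) (i : ι) : ℕ :=
  Module.finrank K (X.space i)

/-- Every `X(i)` is purely even or purely odd, and `p = ∑ i, p(X(i))`, where the zero space has
parity `0`. -/
def HasParity [Fintype ι] (X : SuperRep.{u, v} K Q) (p : ZMod 2) : Prop :=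
  ∃ d : ι → ZMod 2, (∀ i, (X.space i).grade (d i) = ⊤) ∧
    (∀ i, Subsingleton (X.space i) → d i = 0) ∧ ∑ i, d i = p

open Classical in
/-- The simple super-representation `𝕊_i^p`. -/
noncomputable def simple (K : Type u) [Field K] {ι : Type} (Q : ColouredQuiver ι) (i : ι)
    (p : ZMod 2) : SuperRep.{u, u} K Q where
  space j := if j = i then SuperSpace.line K p else SuperSpace.zero K
  map _ := 0
  hasDegree_map _ _ _ _ := Submodule.zero_mem _

/-! #### The super reflection functor

Throughout, `i` is a sink of `Q`, hence a source of `Q' = s_i Q`, and `s_i Q' = Q`. -/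

section Reflection

variable [Finite ι] {i : ι}

/-- For a super-representation `X` of `Q' = s_i Q`, the map `X(i) → ⨁_{i → k} P^{p(i)+p(k)} X(k)`
given by the arrows of `Q'` out of `i`, where `p` is the colouring of `Q'`. -/
noncomputable def outMap (X : SuperRep.{u, v} K (Q.reflect i)) :
    X.space i →ₗ[K] SuperSpace.directSum fun k : {k // Q.arrow k i} =>
      (X.space k).shift ((Q.reflect i).colour i + (Q.reflect i).colour k) :=
  LinearMap.pi fun k => X.map (ColouredQuiver.reflect_arrow_left.2 k.2)

theorem hasDegree_outMap (X : SuperRep.{u, v} K (Q.reflect i)) :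
    SuperSpace.HasDegree (outMap X) 0 := by
  intro p x hx k _
  rw [add_zero]
  exact X.hasDegree_map (ColouredQuiver.reflect_arrow_left.2 k.2) p x hx

open Classical in
/-- The spaces of the reflected super-representation: the cokernel of `outMap` at `i`,
`P^{p(i)} X(j)` at the neighbours `j` of `i`, and `X(j)` elsewhere. -/
noncomputable def reflSpace (X : SuperRep.{u, v} K (Q.reflect i)) (j : ι) : SuperSpace.{u, v} K :=
  if j = i then SuperSpace.coker (outMap X) (hasDegree_outMap X)
  else (X.space j).shift (if Q.arrow j i then Q.colour i else 0)

theorem reflSpace_eq (X : SuperRep.{u, v} K (Q.reflect i)) {j : ι} (h : j = i) :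
    SuperSpace.coker (outMap X) (hasDegree_outMap X) = X.reflSpace j := by
  rw [reflSpace, if_pos h]

open Classical in
theorem reflSpace_ne (X : SuperRep.{u, v} K (Q.reflect i)) {j : ι} (h : j ≠ i) :
    (X.space j).shift (if Q.arrow j i then Q.colour i else 0) = X.reflSpace j := by
  rw [reflSpace, if_neg h]

open Classical in
/-- The identification of the space of the reflected super-representation at `j ≠ i` with `X(j)`,
forgetting the grading. -/
noncomputable def reflEquiv (X : SuperRep.{u, v} K (Q.reflect i)) {j : ι} (h : j ≠ i) :
    X.space j ≃ₗ[K] X.reflSpace j :=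
  (X.space j).shiftEquiv (if Q.arrow j i then Q.colour i else 0) ≪≫ₗ
    SuperSpace.equivOfEq (X.reflSpace_ne h)

open Classical in
theorem reflEquiv_mem (X : SuperRep.{u, v} K (Q.reflect i)) {j : ι} (h : j ≠ i) {p q : ZMod 2}
    (hpq : p = q + if Q.arrow j i then Q.colour i else 0)
    {x : X.space j} (hx : x ∈ (X.space j).grade p) :
    X.reflEquiv h x ∈ (X.reflSpace j).grade q := by
  subst hpq
  exact SuperSpace.equivOfEq_mem (X.reflSpace_ne h) hx

open Classical in
theorem reflEquiv_symm_mem (X : SuperRep.{u, v} K (Q.reflect i)) {j : ι} (h : j ≠ i) {p : ZMod 2}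
    {x : X.reflSpace j} (hx : x ∈ (X.reflSpace j).grade p) :
    (X.reflEquiv h).symm x ∈
      (X.space j).grade (p + if Q.arrow j i then Q.colour i else 0) :=
  SuperSpace.equivOfEq_symm_mem (X.reflSpace_ne h) hx

/-- For an arrow `j → i` of `Q`, the inclusion of `X(j)` in the direct sum followed by the
projection to the cokernel. -/
noncomputable def toCoker (X : SuperRep.{u, v} K (Q.reflect i)) {j : ι} (e : Q.arrow j i) :
    X.space j →ₗ[K] SuperSpace.coker (outMap X) (hasDegree_outMap X) :=
  SuperSpace.cokerMk (outMap X) (hasDegree_outMap X) ∘ₗ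
    SuperSpace.incl (fun k : {k // Q.arrow k i} =>
      (X.space k).shift ((Q.reflect i).colour i + (Q.reflect i).colour k)) ⟨j, e⟩ ∘ₗ
    ((X.space j).shiftEquiv ((Q.reflect i).colour i + (Q.reflect i).colour j)).toLinearMap

open Classical in
/-- The maps of the reflected super-representation: `toCoker` at an arrow `j → i`, and the map
of `X` at the other arrows. -/
noncomputable def reflMap (hi : Q.IsSink i) (X : SuperRep.{u, v} K (Q.reflect i)) {j k : ι}
    (e : Q.arrow j k) : X.reflSpace j →ₗ[K] X.reflSpace k :=
  have hj : j ≠ i := fun h => hi k (h ▸ e)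
  if hk : k = i then
    (SuperSpace.equivOfEq (X.reflSpace_eq hk)).toLinearMap ∘ₗ
      X.toCoker (hk ▸ e) ∘ₗ (X.reflEquiv hj).symm.toLinearMap
  else
    (X.reflEquiv hk).toLinearMap ∘ₗ
      X.map ((ColouredQuiver.reflect_arrow_of_ne hj hk).2 e) ∘ₗ
      (X.reflEquiv hj).symm.toLinearMap

theorem hasDegree_reflMap (hi : Q.IsSink i) (X : SuperRep.{u, v} K (Q.reflect i)) {j k : ι}
    (e : Q.arrow j k) : SuperSpace.HasDegree (X.reflMap hi e) (Q.colour j + Q.colour k) := by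
  classical
  have hj : j ≠ i := fun h => hi k (h ▸ e)
  intro p x hx
  have hy := X.reflEquiv_symm_mem hj hx
  by_cases hk : k = i
  · have e' : Q.arrow j i := hk ▸ e
    simp only [reflMap, dif_pos hk]
    refine SuperSpace.equivOfEq_mem (X.reflSpace_eq hk)
      (SuperSpace.cokerMk_mem _ _ (SuperSpace.incl_mem _ (⟨j, e'⟩ : {k // Q.arrow k i}) ?_))
    have hc : p + (Q.colour j + Q.colour k) + ((Q.reflect i).colour i + (Q.reflect i).colour j)
        = p + if Q.arrow j i then Q.colour i else 0 := by
      rw [hi.reflect_colour, hi.reflect_colour, if_neg (hi i), if_pos e', hk]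
      have : ∀ p a b : ZMod 2, p + (a + b) + (b + 0 + (a + b)) = p + b := by decide
      exact this _ _ _
    rw [← hc] at hy
    exact hy
  · simp only [reflMap, dif_neg hk]
    refine X.reflEquiv_mem hk ?_
      (X.hasDegree_map ((ColouredQuiver.reflect_arrow_of_ne hj hk).2 e) _ _ hy)
    rw [hi.reflect_colour, hi.reflect_colour]
    have : ∀ p a b c d : ZMod 2, p + c + (a + c + (b + d)) = p + (a + b) + d := by decide
    exact this _ _ _ _ _

/-- The super reflection functor `SRep(s_i Γ_col, s_i Ω) → SRep(Γ_col, Ω)`, on objects. -/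
noncomputable def superReflection (hi : Q.IsSink i) (X : SuperRep.{u, v} K (Q.reflect i)) :
    SuperRep.{u, v} K Q where
  space := X.reflSpace
  map := X.reflMap hi
  hasDegree_map := X.hasDegree_reflMap hi

end Reflection

/-- For an adapted word `i_1 ⋯ i_r` and a vertex `i`, the object
`S̃_{i_1} ⋯ S̃_{i_r} (𝕊_i^p)`, where `p` is the colour of `i` in `s_{i_r} ⋯ s_{i_1} Γ_col`. -/
noncomputable def reflectedSimple (K : Type u) [Field K] {ι : Type} [Finite ι] :
    (Q : ColouredQuiver ι) → (l : List ι) → Q.IsAdapted l → ι → SuperRep.{u, u} K Q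
  | Q, [], _, i => simple K Q i (Q.colour i)
  | Q, j :: l, h, i => superReflection h.1 (reflectedSimple K (Q.reflect j) l h.2 i)

/-- The object `S̃_{i_1} ⋯ S̃_{i_{j-1}} (𝕊_{i_j}^{p_j})` attached to a position `j` of an adapted
word; positions are counted from `0`. -/
noncomputable def wordObject (K : Type u) [Field K] {ι : Type} [Finite ι] (Q : ColouredQuiver ι)
    (l : List ι) (hl : Q.IsAdapted l) (j : Fin l.length) : SuperRep.{u, u} K Q :=
  reflectedSimple K Q (l.take j) (hl.take j) (l.get j)

end SuperRep

/-! Forgetting parity, the roots are the differences `e_a - e_b`. A simple system orders the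
coordinates totally and its simple roots join consecutive coordinates (`exists_root_eq`). So the
diagram is a path, and a positive root has all coefficients at most `1` (`coeff_le_one`). The roots
of a reduced word are positive and distinct, and a positive root missed by the word would allow it
to be lengthened (`IsReduced.append_singleton`); a longest word therefore meets each positive root
exactly once.

While `X_α` is built from a simple object, the dimension vectors run through positive roots. No
object is concentrated at the vertex where it is about to be reflected, for its next root would be
negative. Since its spaces have dimension at most `1`, such an indecomposable has an injective
`outMap`. The cokernel then realises the simple reflection on dimension vectors, and a decomposition
of the reflection pulls back to one of the original (`SubRep.isCompl_ofReflection`), so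
indecomposability persists (`reflectedSimple_spec`).

For parity, the invariant is that each space is pure of the colour of its vertex: the parity shifts
in the functor match the changes of colour. Summing over the support gives `p(α)`, because parity is
additive on the root lattice (`rootParity_eq_parityHom`).

Uniqueness needs no reflections. Over a path, an indecomposable with spaces of dimension at most `1`
has nonzero maps between its nonzero spaces, so an isomorphism can be built vertex by vertex. It is
homogeneous because spaces of dimension at most `1` are pure. -/

/-! ### Roots in coordinates and additivity of parity -/

theorem isSuperRoot_iff {n m : ℕ} {α : Fin n ⊕ Fin m → ℤ} :
    IsSuperRoot α ↔ ∃ a b, a ≠ b ∧ α = Pi.single a 1 - Pi.single b 1 := by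
  constructor
  · rintro ((⟨i, j, hij, rfl⟩ | ⟨i, j, hij, rfl⟩) | ⟨i, j, rfl | rfl⟩)
    · exact ⟨Sum.inl i, Sum.inl j, by simpa using hij, rfl⟩
    · exact ⟨Sum.inr i, Sum.inr j, by simpa using hij, rfl⟩
    · exact ⟨Sum.inl i, Sum.inr j, by simp, rfl⟩
    · exact ⟨Sum.inr j, Sum.inl i, by simp, by rw [neg_sub]; rfl⟩
  · rintro ⟨a | a, b | b, hab, rfl⟩
    · exact Or.inl (Or.inl ⟨a, b, by simpa using hab, rfl⟩)
    · exact Or.inr ⟨a, b, Or.inl rfl⟩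
    · exact Or.inr ⟨b, a, Or.inr (by rw [neg_sub]; rfl)⟩
    · exact Or.inl (Or.inr ⟨a, b, by simpa using hab, rfl⟩)

/-- The parity of the root lattice of `A(n,m)`: the sum of the `δ`-coordinates modulo `2`. -/
def parityHom (n m : ℕ) : (Fin n ⊕ Fin m → ℤ) →+ ZMod 2 where
  toFun x := ∑ j, (x (Sum.inr j) : ZMod 2)
  map_zero' := by simp
  map_add' x y := by simp [Finset.sum_add_distrib]

theorem parityHom_epsVec {n m : ℕ} (i : Fin n) : parityHom n m (epsVec i) = 0 := by
  simp [parityHom, epsVec]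

theorem parityHom_delVec {n m : ℕ} (j : Fin m) : parityHom n m (delVec j) = 1 := by
  simp [parityHom, delVec, Pi.single_apply]

/-- `rootParity` is defined root by root; a homomorphism makes it computable from the coefficients
in the simple roots. -/
theorem rootParity_eq_parityHom {n m : ℕ} {α : Fin n ⊕ Fin m → ℤ} (h : IsSuperRoot α) :
    rootParity α = parityHom n m α := by
  rw [rootParity]
  split_ifs with h'
  · obtain ⟨i, j, rfl | rfl⟩ := h' <;>
      simp [parityHom_epsVec, parityHom_delVec] 
  · obtain ⟨i, j, -, rfl⟩ | ⟨i, j, -, rfl⟩ := h.resolve_right h' <;>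
      simp [parityHom_epsVec, parityHom_delVec]

section Coordinates

variable {κ : Type} [DecidableEq κ]

theorem dotProduct_single_sub_single [Fintype κ] (x : κ → ℤ) (a b : κ) :
    x ⬝ᵥ (Pi.single a 1 - Pi.single b 1) = x a - x b := by
  simp [dotProduct_sub]

/-- Reflections act as transpositions of coordinates, hence permute the roots. -/
theorem sub_dotProduct_smul_eq_comp_swap [Fintype κ] (x : κ → ℤ) {c d : κ} (hcd : c ≠ d) :
    x - (x ⬝ᵥ (Pi.single c 1 - Pi.single d 1)) • (Pi.single c 1 - Pi.single d 1 : κ → ℤ) =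
      x ∘ Equiv.swap c d := by
  rw [dotProduct_single_sub_single]
  funext k
  by_cases hc : k = c
  · subst hc
    simp [hcd]
  by_cases hd : k = d
  · subst hd
    simp [hc]
  simp [hc, hd, Equiv.swap_apply_of_ne_of_ne hc hd]

theorem single_comp_swap (a c d : κ) :
    (Pi.single a 1 : κ → ℤ) ∘ Equiv.swap c d = Pi.single (Equiv.swap c d a) 1 := by
  funext k
  simp only [Function.comp, Pi.single_apply, Equiv.swap_apply_eq_iff]

end Coordinates

theorem IsSuperRoot.neg {n m : ℕ} {α : Fin n ⊕ Fin m → ℤ} (h : IsSuperRoot α) :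
    IsSuperRoot (-α) := by
  obtain ⟨a, b, hab, rfl⟩ := isSuperRoot_iff.1 h
  exact isSuperRoot_iff.2 ⟨b, a, hab.symm, by rw [neg_sub]⟩

theorem IsSuperRoot.dotProduct_self {n m : ℕ} {α : Fin n ⊕ Fin m → ℤ} (h : IsSuperRoot α) :
    α ⬝ᵥ α = 2 := by
  obtain ⟨a, b, hab, rfl⟩ := isSuperRoot_iff.1 h
  rw [dotProduct_single_sub_single]
  simp [hab, hab.symm]

theorem IsSuperRoot.ne_zero {n m : ℕ} {α : Fin n ⊕ Fin m → ℤ} (h : IsSuperRoot α) : α ≠ 0 := by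
  rintro rfl
  simpa using h.dotProduct_self

/-! ### Positive roots and simple reflections -/

namespace SimpleSystem

variable {n m : ℕ} {ι : Type} [Fintype ι] (S : SimpleSystem n m ι)

theorem simpleReflection_apply (i : ι) (x : Fin n ⊕ Fin m → ℤ) :
    S.simpleReflection i x = x - (x ⬝ᵥ S.root i) • S.root i := rfl

theorem isSuperRoot_simpleReflection (i : ι) {α : Fin n ⊕ Fin m → ℤ} (h : IsSuperRoot α) :
    IsSuperRoot (S.simpleReflection i α) := by
  obtain ⟨a, b, hab, rfl⟩ := isSuperRoot_iff.1 h
  obtain ⟨c, d, hcd, hi⟩ := isSuperRoot_iff.1 (S.isRoot i)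
  rw [simpleReflection_apply, hi, sub_dotProduct_smul_eq_comp_swap _ hcd]
  refine isSuperRoot_iff.2 ⟨Equiv.swap c d a, Equiv.swap c d b, by simpa using hab, ?_⟩
  rw [← single_comp_swap, ← single_comp_swap]
  rfl

theorem simpleReflection_root (i : ι) : S.simpleReflection i (S.root i) = -S.root i := by
  rw [simpleReflection_apply, (S.isRoot i).dotProduct_self]
  module

theorem simpleReflection_simpleReflection (i : ι) (x : Fin n ⊕ Fin m → ℤ) :
    S.simpleReflection i (S.simpleReflection i x) = x := by
  have h := S.simpleReflection_root i
  conv_lhs => rw [simpleReflection_apply S i x]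
  rw [map_sub, map_smul, h, simpleReflection_apply]
  module

theorem simpleReflection_dotProduct (i : ι) (x y : Fin n ⊕ Fin m → ℤ) :
    S.simpleReflection i x ⬝ᵥ S.simpleReflection i y = x ⬝ᵥ y := by
  simp only [simpleReflection_apply, sub_dotProduct, dotProduct_sub, smul_dotProduct,
    dotProduct_smul, (S.isRoot i).dotProduct_self, smul_eq_mul, dotProduct_comm (S.root i) y]
  ring

variable {S}

theorem coeff_ext {c d : ι → ℤ} (h : ∑ i, c i • S.root i = ∑ i, d i • S.root i) : c = d := by
  funext i
  have h0 : ∑ i, (c i - d i) • S.root i = 0 := by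
    simp only [sub_smul, Finset.sum_sub_distrib, h, sub_self]
  exact sub_eq_zero.1 (Fintype.linearIndependent_iff.1 S.linearIndependent _ h0 i)

theorem sum_natCast_smul (c : ι → ℕ) :
    ∑ i, (c i : ℤ) • S.root i = ∑ i, c i • S.root i := by
  simp only [natCast_zsmul]

theorem sum_single_smul [DecidableEq ι] (i : ι) :
    ∑ j, (Pi.single i 1 : ι → ℤ) j • S.root j = S.root i := by
  simp [Pi.single_apply]

variable (S) in
theorem isPositiveRoot_root (i : ι) : S.IsPositiveRoot (S.root i) := by
  classical
  exact ⟨S.isRoot i, Pi.single i 1, by simp [Pi.single_apply]⟩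

theorem IsPositiveRoot.not_neg {α : Fin n ⊕ Fin m → ℤ} (h : S.IsPositiveRoot α) :
    ¬ S.IsPositiveRoot (-α) := by
  rintro ⟨-, d, hd⟩
  obtain ⟨hr, c, hc⟩ := h
  have h0 : (fun i => ((c i + d i : ℕ) : ℤ)) = fun _ => 0 := by
    apply coeff_ext (S := S)
    simp only [Nat.cast_add, add_smul, Finset.sum_add_distrib, sum_natCast_smul, ← hc, ← hd]
    simp
  have hc0 : ∀ i, c i = 0 := fun i => by
    have := congrFun h0 i
    omega
  exact hr.ne_zero (by simp [hc, hc0])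

theorem isPositiveRoot_or_neg {α : Fin n ⊕ Fin m → ℤ} (h : IsSuperRoot α) :
    S.IsPositiveRoot α ∨ S.IsPositiveRoot (-α) :=
  (S.pos_or_neg α h).imp (fun h' => ⟨h, h'⟩) fun h' => ⟨h.neg, h'⟩

/-- The simple reflection `s_i` permutes the positive roots other than `α_i`. -/
theorem IsPositiveRoot.simpleReflection {α : Fin n ⊕ Fin m → ℤ} (h : S.IsPositiveRoot α) {i : ι}
    (hi : α ≠ S.root i) : S.IsPositiveRoot (S.simpleReflection i α) := by
  classical
  refine (isPositiveRoot_or_neg (S.isSuperRoot_simpleReflection i h.1)).resolve_right ?_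
  rintro ⟨-, d, hd⟩
  obtain ⟨hr, c, hc⟩ := h
  -- If `s_i α` were negative, adding the expansions of `α` and `-s_i α` would give a multiple of
  -- `α_i`. Nonnegativity then kills every coefficient of `α` away from `i`.
  have h0 : (fun j => ((c j + d j : ℕ) : ℤ)) =
      fun j => (α ⬝ᵥ S.root i) * (Pi.single i 1 : ι → ℤ) j := by
    apply coeff_ext (S := S)
    simp only [Nat.cast_add, add_smul, Finset.sum_add_distrib, sum_natCast_smul, ← hc, ← hd,
      mul_smul, ← Finset.smul_sum, sum_single_smul, simpleReflection_apply]
    module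
  have hc0 : ∀ j, j ≠ i → c j = 0 := fun j hj => by
    have := congrFun h0 j
    simp only [Pi.single_eq_of_ne hj, mul_zero] at this
    omega
  have hα : α = c i • S.root i := by
    rw [hc]
    exact Finset.sum_eq_single i (fun j _ hj => by simp [hc0 j hj]) (by simp)
  -- Both roots have square length 2, so the remaining coefficient is `1`.
  have h2 := hr.dotProduct_self
  rw [hα, smul_dotProduct, dotProduct_smul, (S.isRoot i).dotProduct_self] at h2
  have hci : c i = 1 := by
    simp only [nsmul_eq_mul] at h2
    have h3 : (c i : ℤ) * c i = 1 := by linarith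
    have h4 : c i * c i = 1 := by exact_mod_cast h3
    exact Nat.eq_one_of_mul_eq_one_left h4
  exact hi (by rw [hα, hci, one_smul])

/-! ### The total order on coordinates -/

variable (S) in
/-- The number of coordinates `c` for which `e_c - e_a` is a positive root. -/
noncomputable def coordRank (a : Fin n ⊕ Fin m) : ℕ :=
  {c | S.IsPositiveRoot (Pi.single c 1 - Pi.single a 1)}.ncard

theorem isPositiveRoot_trans {a b c : Fin n ⊕ Fin m}
    (hab : S.IsPositiveRoot (Pi.single a 1 - Pi.single b 1))
    (hbc : S.IsPositiveRoot (Pi.single b 1 - Pi.single c 1)) :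
    S.IsPositiveRoot (Pi.single a 1 - Pi.single c 1) := by
  have hac : a ≠ c := by
    rintro rfl
    exact hab.not_neg (by rwa [neg_sub])
  refine ⟨isSuperRoot_iff.2 ⟨a, c, hac, rfl⟩, ?_⟩
  obtain ⟨x, hx⟩ := hab.2
  obtain ⟨y, hy⟩ := hbc.2
  refine ⟨x + y, ?_⟩
  simp only [Pi.add_apply, add_smul, Finset.sum_add_distrib, ← hx, ← hy]
  abel

theorem not_isPositiveRoot_sub_self (x : Fin n ⊕ Fin m → ℤ) : ¬ S.IsPositiveRoot (x - x) :=
  fun h => h.1.ne_zero (sub_self x)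

theorem coordRank_lt {a b : Fin n ⊕ Fin m}
    (hab : S.IsPositiveRoot (Pi.single a 1 - Pi.single b 1)) : S.coordRank a < S.coordRank b := by
  refine Set.ncard_lt_ncard ⟨fun c hc => isPositiveRoot_trans hc hab, fun h => ?_⟩
    (Set.toFinite _)
  exact not_isPositiveRoot_sub_self (S := S) _ (h hab)

variable (S) in
theorem coordRank_injective : Function.Injective S.coordRank := by
  intro a b h
  by_contra hab
  rcases isPositiveRoot_or_neg (S := S) (isSuperRoot_iff.2 ⟨a, b, hab, rfl⟩) with h' | h'
  · exact (coordRank_lt h').ne h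
  · rw [neg_sub] at h'
    exact (coordRank_lt h').ne h.symm

/-- A simple root is not the sum of two positive roots. -/
theorem root_ne_add (i : ι) {x y : Fin n ⊕ Fin m → ℤ} (hx : S.IsPositiveRoot x)
    (hy : S.IsPositiveRoot y) : S.root i ≠ x + y := by
  classical
  intro h
  obtain ⟨hx, c, hc⟩ := hx
  obtain ⟨hy, d, hd⟩ := hy
  have h0 : (fun j => ((c j + d j : ℕ) : ℤ)) = Pi.single i 1 := by
    apply coeff_ext (S := S)
    simp only [Nat.cast_add, add_smul, Finset.sum_add_distrib, sum_natCast_smul, ← hc, ← hd,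
      sum_single_smul, h]
  -- Both summands need a nonzero coefficient at `i`, since they vanish elsewhere; the total there
  -- would be at least 2.
  have hne : ∀ {z : Fin n ⊕ Fin m → ℤ} {b : ι → ℕ}, IsSuperRoot z → z = ∑ j, b j • S.root j →
      (∀ j, j ≠ i → b j = 0) → b i ≠ 0 := by
    rintro z b hz hb hj h
    refine hz.ne_zero (hb.trans (Finset.sum_eq_zero fun j _ => ?_))
    by_cases hji : j = i
    · simp [hji, h]
    · simp [hj j hji]
  have hj : ∀ j, j ≠ i → c j + d j = 0 := fun j hj => by
    have := congrFun h0 j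
    simp only [Pi.single_eq_of_ne hj] at this
    exact_mod_cast this
  have h1 := hne hx hc fun j h => by have := hj j h; omega
  have h2 := hne hy hd fun j h => by have := hj j h; omega
  have := congrFun h0 i
  simp only [Pi.single_eq_same] at this
  omega

variable (S) in
-- A coordinate strictly between `a` and `b` would write the simple root as a sum of two positive
-- roots. Thus the predecessors of `b` are `a` and the predecessors of `a`.
theorem exists_root_eq (i : ι) : ∃ a b : Fin n ⊕ Fin m,
    S.root i = Pi.single a 1 - Pi.single b 1 ∧ S.coordRank b = S.coordRank a + 1 := by
  obtain ⟨a, b, hab, hi⟩ := isSuperRoot_iff.1 (S.isRoot i)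
  refine ⟨a, b, hi, ?_⟩
  have hpos : S.IsPositiveRoot (Pi.single a 1 - Pi.single b 1) := hi ▸ S.isPositiveRoot_root i
  have hset : {c | S.IsPositiveRoot (Pi.single c 1 - Pi.single b 1)} =
      insert a {c | S.IsPositiveRoot (Pi.single c 1 - Pi.single a 1)} := by
    ext c
    simp only [Set.mem_ofPred_eq, Set.mem_insert_iff]
    constructor
    · intro hc
      by_cases hca : c = a
      · exact Or.inl hca
      refine Or.inr ((isPositiveRoot_or_neg
        (isSuperRoot_iff.2 ⟨c, a, hca, rfl⟩)).resolve_right fun h => ?_)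
      rw [neg_sub] at h
      exact root_ne_add i h hc (by rw [hi]; abel)
    · rintro (rfl | h)
      · exact hpos
      · exact isPositiveRoot_trans h hpos
  rw [coordRank, hset, Set.ncard_insert_of_notMem _ (Set.toFinite _)]
  · rfl
  · exact not_isPositiveRoot_sub_self _

variable (S) in
/-- The coordinate `a` of a simple root `e_a - e_b`. -/
noncomputable def fstCoord (i : ι) : Fin n ⊕ Fin m := (S.exists_root_eq i).choose

variable (S) in
/-- The coordinate `b` of a simple root `e_a - e_b`. -/
noncomputable def sndCoord (i : ι) : Fin n ⊕ Fin m := (S.exists_root_eq i).choose_spec.choose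

variable (S) in
theorem root_eq (i : ι) :
    S.root i = Pi.single (S.fstCoord i) 1 - Pi.single (S.sndCoord i) 1 :=
  (S.exists_root_eq i).choose_spec.choose_spec.1

variable (S) in
/-- The position of a vertex in the Dynkin diagram, which is a path. -/
noncomputable def position (i : ι) : ℕ := S.coordRank (S.fstCoord i)

variable (S) in
theorem coordRank_sndCoord (i : ι) : S.coordRank (S.sndCoord i) = S.position i + 1 :=
  (S.exists_root_eq i).choose_spec.choose_spec.2

variable (S) in
theorem position_injective : Function.Injective S.position := by
  intro i j h
  have h1 : S.fstCoord i = S.fstCoord j := S.coordRank_injective h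
  have h2 : S.sndCoord i = S.sndCoord j :=
    S.coordRank_injective (by rw [coordRank_sndCoord, coordRank_sndCoord, h])
  exact S.linearIndependent.injective (by rw [S.root_eq i, S.root_eq j, h1, h2])

variable (S) in
theorem coordRank_fstCoord (i : ι) : S.coordRank (S.fstCoord i) = S.position i := rfl

theorem dotProduct_root_of_position {i j : ι} (hij : i ≠ j) : S.root i ⬝ᵥ S.root j =
    if S.position i = S.position j + 1 ∨ S.position j = S.position i + 1 then -1 else 0 := by
  have h3 : S.position i ≠ S.position j := S.position_injective.ne hij
  have heq : ∀ a b, (a = b ↔ S.coordRank a = S.coordRank b) := fun a b =>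
    S.coordRank_injective.eq_iff.symm
  rw [S.root_eq j, dotProduct_single_sub_single, S.root_eq i]
  simp only [Pi.sub_apply, Pi.single_apply, heq, coordRank_sndCoord, coordRank_fstCoord]
  repeat' split_ifs
  all_goals omega

theorem dynkinGraph_adj_iff {i j : ι} : S.dynkinGraph.Adj i j ↔
    S.position i = S.position j + 1 ∨ S.position j = S.position i + 1 := by
  change i ≠ j ∧ S.root i ⬝ᵥ S.root j ≠ 0 ↔ _
  by_cases hij : i = j
  · subst hij
    simp
  · rw [dotProduct_root_of_position hij]
    simp [hij, or_iff_not_imp_left]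

open Classical in
theorem dotProduct_root_of_ne {i j : ι} (h : i ≠ j) :
    S.root i ⬝ᵥ S.root j = if S.dynkinGraph.Adj i j then -1 else 0 := by
  simp only [dotProduct_root_of_position h, dynkinGraph_adj_iff]

/-- The coefficients of a root with respect to a simple system are at most `1`. -/
theorem coeff_le_one {c : ι → ℕ} (h : IsSuperRoot (∑ i, c i • S.root i)) (i : ι) : c i ≤ 1 := by
  obtain ⟨a, b, -, hab⟩ := isSuperRoot_iff.1 h
  -- The indicator of an initial segment of the coordinates, cut at `α_i`. No other simple root
  -- crosses the cut, so pairing with `f` reads off `c i`; on any `e_a - e_b` the pairing is at most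
  -- `1`.
  let f : Fin n ⊕ Fin m → ℤ := fun a => if S.coordRank a ≤ S.position i then 1 else 0
  have hf : ∀ a b, f ⬝ᵥ (Pi.single a 1 - Pi.single b 1) = f a - f b :=
    dotProduct_single_sub_single f
  have h1 : f ⬝ᵥ (∑ j, c j • S.root j) = c i := by
    rw [dotProduct_sum, Finset.sum_eq_single i]
    · rw [dotProduct_smul, root_eq, hf]
      simp [f, coordRank_sndCoord, coordRank_fstCoord]
    · intro j _ hj
      have h3 := S.position_injective.ne hj
      rw [dotProduct_smul, root_eq, hf]
      simp only [f, coordRank_sndCoord, coordRank_fstCoord]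
      have : S.position j ≤ S.position i ↔ S.position j + 1 ≤ S.position i := by omega
      simp [this]
    · simp
  rw [hab, hf] at h1
  have : (c i : ℤ) ≤ 1 := by
    rw [← h1]
    simp only [f]
    split_ifs <;> norm_num
  exact_mod_cast this

/-! ### Words in the simple reflections -/

variable (S) in
@[simp] theorem wordProd_nil : S.wordProd [] = 1 := rfl

variable (S) in
theorem wordProd_cons (i : ι) (l : List ι) (x : Fin n ⊕ Fin m → ℤ) :
    S.wordProd (i :: l) x = S.simpleReflection i (S.wordProd l x) := by
  simp [wordProd]

variable (S) in
theorem wordProd_append (l l' : List ι) :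
    S.wordProd (l ++ l') = S.wordProd l * S.wordProd l' := by
  simp [wordProd]

variable (S) in
theorem wordProd_append_singleton (l : List ι) (i : ι) (x : Fin n ⊕ Fin m → ℤ) :
    S.wordProd (l ++ [i]) x = S.wordProd l (S.simpleReflection i x) := by
  simp [wordProd]

variable (S) in
theorem wordProd_reverse_mul (l : List ι) : S.wordProd l.reverse * S.wordProd l = 1 := by
  refine LinearMap.ext fun x => ?_
  induction l generalizing x with
  | nil => rfl
  | cons i l ih =>
    rw [Module.End.mul_apply, List.reverse_cons, wordProd_append_singleton, wordProd_cons,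
      simpleReflection_simpleReflection]
    exact ih x

variable (S) in
theorem wordProd_mul_reverse (l : List ι) : S.wordProd l * S.wordProd l.reverse = 1 := by
  simpa using S.wordProd_reverse_mul l.reverse

variable (S) in
theorem wordProd_reverse_apply (l : List ι) (x : Fin n ⊕ Fin m → ℤ) :
    S.wordProd l.reverse (S.wordProd l x) = x :=
  LinearMap.congr_fun (S.wordProd_reverse_mul l) x

variable (S) in
theorem wordProd_apply_reverse (l : List ι) (x : Fin n ⊕ Fin m → ℤ) :
    S.wordProd l (S.wordProd l.reverse x) = x :=
  LinearMap.congr_fun (S.wordProd_mul_reverse l) x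

theorem wordProd_reverse_congr {l l' : List ι} (h : S.wordProd l = S.wordProd l') :
    S.wordProd l.reverse = S.wordProd l'.reverse :=
  left_inv_eq_right_inv (S.wordProd_reverse_mul l) (h ▸ S.wordProd_mul_reverse l')

variable (S) in
theorem isSuperRoot_wordProd (l : List ι) {α : Fin n ⊕ Fin m → ℤ} (h : IsSuperRoot α) :
    IsSuperRoot (S.wordProd l α) := by
  induction l with
  | nil => exact h
  | cons i l ih =>
    rw [wordProd_cons]
    exact S.isSuperRoot_simpleReflection i ih

variable (S) in
theorem wordProd_dotProduct (l : List ι) (x y : Fin n ⊕ Fin m → ℤ) :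
    S.wordProd l x ⬝ᵥ S.wordProd l y = x ⬝ᵥ y := by
  induction l with
  | nil => rfl
  | cons i l ih => rw [wordProd_cons, wordProd_cons, simpleReflection_dotProduct, ih]

theorem IsReduced.of_append_left {l l' : List ι} (h : S.IsReduced (l ++ l')) : S.IsReduced l := by
  intro t ht
  have := h (t ++ l') (by rw [wordProd_append, wordProd_append, ht])
  simpa using this

theorem IsReduced.of_append_right {l l' : List ι} (h : S.IsReduced (l ++ l')) :
    S.IsReduced l' := by
  intro t ht
  have := h (l ++ t) (by rw [wordProd_append, wordProd_append, ht])
  simpa using this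

theorem IsReduced.of_cons {i : ι} {l : List ι} (h : S.IsReduced (i :: l)) : S.IsReduced l :=
  IsReduced.of_append_right (l := [i]) h

theorem IsReduced.reverse {l : List ι} (h : S.IsReduced l) : S.IsReduced l.reverse := by
  intro t ht
  have := h t.reverse (by rw [wordProd_reverse_congr ht, List.reverse_reverse])
  simpa using this

/-- Letters are applied from the right, and positivity can fail only when the current root `w α_i`
equals `α_j`. Then `s_j w s_i = w`, which shortens the word by two letters. -/
theorem IsReduced.isPositiveRoot {l : List ι} {i : ι} (h : S.IsReduced (l ++ [i])) :
    S.IsPositiveRoot (S.wordProd l (S.root i)) := by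
  induction l with
  | nil => exact S.isPositiveRoot_root i
  | cons j l ih =>
    rw [wordProd_cons]
    refine (ih h.of_cons).simpleReflection fun hj => ?_
    have hprod : S.wordProd l = S.wordProd (j :: l ++ [i]) := by
      refine LinearMap.ext fun x => ?_
      rw [wordProd_append_singleton, wordProd_cons, simpleReflection_apply, ← hj,
        wordProd_dotProduct, ← map_smul, ← map_sub, ← simpleReflection_apply,
        simpleReflection_simpleReflection]
    have := h l hprod
    simp at this

theorem IsReduced.isPositiveRoot_wordRoot {l : List ι} (h : S.IsReduced l) (j : Fin l.length) :
    S.IsPositiveRoot (S.wordRoot l j) := by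
  refine IsReduced.isPositiveRoot (IsReduced.of_append_left (l' := l.drop (j + 1)) ?_)
  simpa using h

variable (S) in
@[simp] theorem wordRoot_zero (i : ι) (l : List ι) (h : 0 < (i :: l).length) :
    S.wordRoot (i :: l) ⟨0, h⟩ = S.root i := rfl

variable (S) in
theorem wordRoot_succ (i : ι) (l : List ι) (j : ℕ) (h : j < l.length) :
    S.wordRoot (i :: l) ⟨j + 1, Nat.succ_lt_succ h⟩ =
      S.simpleReflection i (S.wordRoot l ⟨j, h⟩) := by
  simp [wordRoot, wordProd_cons]

/-- After the common initial letters are cancelled, a repetition would make a root of the remaining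
reduced word equal to `-α_i`. -/
theorem IsReduced.wordRoot_injective {l : List ι} (h : S.IsReduced l) :
    Function.Injective (S.wordRoot l) := by
  have key : ∀ (i : ι) (l : List ι), S.IsReduced (i :: l) → ∀ k,
      S.root i ≠ S.simpleReflection i (S.wordRoot l k) := by
    intro i l h k hk
    have h1 := congrArg (S.simpleReflection i) hk
    rw [simpleReflection_simpleReflection, simpleReflection_root] at h1
    exact (S.isPositiveRoot_root i).not_neg (h1 ▸ h.of_cons.isPositiveRoot_wordRoot k)
  induction l with
  | nil => exact fun j => j.elim0
  | cons i l ih =>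
    rintro ⟨j, hj⟩ ⟨k, hk⟩ hjk
    rcases j with _ | j <;> rcases k with _ | k
    · rfl
    · rw [wordRoot_zero, wordRoot_succ S i l k (Nat.lt_of_succ_lt_succ hk)] at hjk
      exact absurd hjk (key i l h _)
    · rw [wordRoot_zero, wordRoot_succ S i l j (Nat.lt_of_succ_lt_succ hj)] at hjk
      exact absurd hjk.symm (key i l h _)
    · rw [wordRoot_succ S i l j (Nat.lt_of_succ_lt_succ hj),
        wordRoot_succ S i l k (Nat.lt_of_succ_lt_succ hk)] at hjk
      have h1 := congrArg (S.simpleReflection i) hjk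
      rw [simpleReflection_simpleReflection, simpleReflection_simpleReflection] at h1
      have := ih h.of_cons h1
      simp only [Fin.mk.injEq] at this
      simp [this]

/-- A positive root made negative by the inverse of `s_{i_1} ⋯ s_{i_l}` is one of the roots of
the word. -/
theorem IsPositiveRoot.exists_wordRoot_eq {l : List ι} {α : Fin n ⊕ Fin m → ℤ}
    (hα : S.IsPositiveRoot α) (h : ¬ S.IsPositiveRoot (S.wordProd l.reverse α)) :
    ∃ j, S.wordRoot l j = α := by
  induction l generalizing α with
  | nil => exact absurd hα h
  | cons i l ih =>
    -- Following `α` through the successive reflections, it stays positive until it equals the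
    -- simple root being reflected; this must happen somewhere, and there `α` is the root of the
    -- word.
    by_cases hi : α = S.root i
    · exact ⟨⟨0, by simp⟩, by rw [wordRoot_zero, hi]⟩
    · rw [List.reverse_cons, wordProd_append_singleton] at h
      obtain ⟨⟨j, hj⟩, hjα⟩ := ih (hα.simpleReflection hi) h
      refine ⟨⟨j + 1, Nat.succ_lt_succ hj⟩, ?_⟩
      rw [wordRoot_succ S i l j hj, hjα, simpleReflection_simpleReflection]

/-- Cancelling initial letters reduces to position `0`, where the claim is positivity for the
reversed word, which is again reduced. -/
theorem IsReduced.isPositiveRoot_neg_reverse {l : List ι} (h : S.IsReduced l)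
    (j : Fin l.length) : S.IsPositiveRoot (-S.wordProd l.reverse (S.wordRoot l j)) := by
  induction l with
  | nil => exact j.elim0
  | cons i l ih =>
    obtain ⟨j, hj⟩ := j
    rw [List.reverse_cons, wordProd_append_singleton]
    rcases j with _ | j
    · rw [wordRoot_zero, simpleReflection_root, map_neg, neg_neg]
      exact IsReduced.isPositiveRoot (by simpa using h.reverse)
    · rw [wordRoot_succ S i l j (Nat.lt_of_succ_lt_succ hj), simpleReflection_simpleReflection]
      exact ih h.of_cons _

/-- Any word with the same product has the same inversions. These include the distinct roots of `l`
and the new root, so its length is at least `l.length + 1`. -/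
theorem IsReduced.append_singleton {l : List ι} (h : S.IsReduced l) {i : ι}
    (hi : S.IsPositiveRoot (S.wordProd l (S.root i))) : S.IsReduced (l ++ [i]) := by
  intro l' hl'
  have hsub : insert (S.wordProd l (S.root i)) (Set.range (S.wordRoot l)) ⊆
      Set.range (S.wordRoot l') := by
    rintro α (rfl | ⟨j, rfl⟩)
    · refine hi.exists_wordRoot_eq ?_
      rw [wordProd_reverse_congr hl', List.reverse_append, List.reverse_singleton,
        List.singleton_append, wordProd_cons, wordProd_reverse_apply, simpleReflection_root]
      exact (S.isPositiveRoot_root i).not_neg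
    · refine (h.isPositiveRoot_wordRoot j).exists_wordRoot_eq fun hneg => ?_
      rw [wordProd_reverse_congr hl', List.reverse_append, List.reverse_singleton,
        List.singleton_append, wordProd_cons] at hneg
      -- The last reflection `s_i` could undo the negativity only if `w⁻¹` sent the root to `-α_i`,
      -- against the positivity of `w α_i`.
      have hp := (h.isPositiveRoot_neg_reverse j).simpleReflection (i := i) fun heq => ?_
      · rw [map_neg] at hp
        exact hneg.not_neg hp
      · rw [← heq, map_neg, wordProd_apply_reverse] at hi
        exact (h.isPositiveRoot_wordRoot j).not_neg hi
  have hnot : S.wordProd l (S.root i) ∉ Set.range (S.wordRoot l) := by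
    rintro ⟨j, hj⟩
    have h1 := h.isPositiveRoot_neg_reverse j
    rw [hj, wordProd_reverse_apply] at h1
    exact (S.isPositiveRoot_root i).not_neg h1
  have h1 := Set.ncard_le_ncard hsub (Set.toFinite _)
  rw [Set.ncard_insert_of_notMem hnot (Set.toFinite _), ← Set.image_univ, ← Set.image_univ,
    Set.ncard_image_of_injective _ h.wordRoot_injective, Set.ncard_univ] at h1
  have h2 : (S.wordRoot l' '' Set.univ).ncard ≤ l'.length := by
    refine (Set.ncard_image_le (Set.toFinite _)).trans ?_
    simp [Set.ncard_univ]
  simp only [Nat.card_eq_fintype_card, Fintype.card_fin] at h1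
  simp only [List.length_append, List.length_singleton]
  omega

/-- If an element of the Weyl group sends some positive root to a positive root, it does so for
some simple root. -/
theorem exists_isPositiveRoot_wordProd {l : List ι} {γ : Fin n ⊕ Fin m → ℤ}
    (hγ : S.IsPositiveRoot γ) (h : S.IsPositiveRoot (S.wordProd l γ)) :
    ∃ i, S.IsPositiveRoot (S.wordProd l (S.root i)) := by
  by_contra! hneg
  obtain ⟨c, hc⟩ := hγ.2
  have hd : ∀ i, ∃ d : ι → ℕ, -S.wordProd l (S.root i) = ∑ j, d j • S.root j := fun i =>
    ((isPositiveRoot_or_neg (S.isSuperRoot_wordProd l (S.isRoot i))).resolve_left (hneg i)).2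
  choose d hd using hd
  refine h.not_neg ⟨h.1.neg, fun j => ∑ i, c i * d i j, ?_⟩
  rw [hc, map_sum, ← Finset.sum_neg_distrib]
  simp only [map_nsmul, ← smul_neg, hd, Finset.sum_smul, Finset.smul_sum, mul_smul]
  exact Finset.sum_comm

/-- For a missed root `α`, the positive root `w⁻¹ α` is sent by `w` to a positive root. Hence some
`w α_i` is positive, and appending `i` gives a longer reduced word. -/
theorem IsReducedLongest.exists_wordRoot_eq {l : List ι} (hl : S.IsReducedLongest l)
    {α : Fin n ⊕ Fin m → ℤ} (hα : S.IsPositiveRoot α) : ∃ j, S.wordRoot l j = α := by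
  refine hα.exists_wordRoot_eq fun h => ?_
  obtain ⟨i, hi⟩ := exists_isPositiveRoot_wordProd (l := l) h
    (by rwa [wordProd_apply_reverse])
  have := hl.2 _ (hl.1.append_singleton hi)
  simp at this

end SimpleSystem

/-! ### Graded subspaces -/

namespace SuperSpace

variable {K : Type u} [Field K]

theorem exists_add_eq (V : SuperSpace.{u, v} K) (x : V) :
    ∃ y ∈ V.grade 0, ∃ z ∈ V.grade 1, y + z = x :=
  Submodule.mem_sup.1 (V.isCompl.sup_eq_top ▸ Submodule.mem_top)

/-- A graded subspace. -/
def IsGraded (V : SuperSpace.{u, v} K) (S : Submodule K V) : Prop :=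
  S = (S ⊓ V.grade 0) ⊔ (S ⊓ V.grade 1)

variable {V : SuperSpace.{u, v} K} {W : SuperSpace.{u, w} K}

/-- This form, closure under homogeneous components, is easy to pull back and intersect. -/
theorem isGraded_iff {S : Submodule K V} : V.IsGraded S ↔
    ∀ y ∈ V.grade 0, ∀ z ∈ V.grade 1, y + z ∈ S → y ∈ S ∧ z ∈ S := by
  constructor
  · intro h y hy z hz hyz
    have hyz' := hyz
    rw [h] at hyz'
    obtain ⟨a, ha, b, hb, hab⟩ := Submodule.mem_sup.1 hyz'
    have key : y - a = b - z := by
      rw [sub_eq_sub_iff_add_eq_add, add_comm b a, hab]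
    have h0 := (Submodule.disjoint_def.1 V.isCompl.disjoint) (y - a) (sub_mem hy ha.2)
      (key ▸ sub_mem hb.2 hz)
    obtain rfl := sub_eq_zero.1 h0
    rw [sub_self] at key
    obtain rfl := sub_eq_zero.1 key.symm
    exact ⟨ha.1, hb.1⟩
  · intro h
    refine le_antisymm (fun x hx => ?_) (sup_le inf_le_left inf_le_left)
    obtain ⟨y, hy, z, hz, rfl⟩ := V.exists_add_eq x
    obtain ⟨h1, h2⟩ := h y hy z hz hx
    exact Submodule.add_mem_sup ⟨h1, hy⟩ ⟨h2, hz⟩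

theorem IsGraded.comap {f : V →ₗ[K] W} {d : ZMod 2} (hf : HasDegree f d) {S : Submodule K W}
    (hS : W.IsGraded S) : V.IsGraded (S.comap f) := by
  rw [isGraded_iff] at hS ⊢
  intro y hy z hz hyz
  have hy' := hf 0 y hy
  have hz' := hf 1 z hz
  rw [Submodule.mem_comap, map_add] at hyz
  have h2 : ∀ d : ZMod 2, d = 0 ∨ d = 1 := by decide
  rcases h2 d with rfl | rfl
  · exact hS _ hy' _ hz' hyz
  · rw [add_comm] at hyz
    exact (hS _ hz' _ hy' hyz).symm

theorem IsGraded.iInf {κ : Sort*} {S : κ → Submodule K V} (hS : ∀ k, V.IsGraded (S k)) :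
    V.IsGraded (⨅ k, S k) := by
  simp only [isGraded_iff] at hS ⊢
  intro y hy z hz hyz
  simp only [Submodule.mem_iInf] at hyz ⊢
  exact ⟨fun k => (hS k y hy z hz (hyz k)).1, fun k => (hS k y hy z hz (hyz k)).2⟩

theorem IsGraded.inf {S T : Submodule K V} (hS : V.IsGraded S) (hT : V.IsGraded T) :
    V.IsGraded (S ⊓ T) := by
  rw [isGraded_iff] at hS hT ⊢
  intro y hy z hz hyz
  have h1 := hS y hy z hz hyz.1
  have h2 := hT y hy z hz hyz.2
  exact ⟨⟨h1.1, h2.1⟩, h1.2, h2.2⟩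

theorem isGraded_bot : V.IsGraded ⊥ := by
  simp [IsGraded]

theorem isGraded_top : V.IsGraded ⊤ := by
  simp [IsGraded, V.isCompl.sup_eq_top]

theorem HasDegree.comp {U V W : SuperSpace.{u, v} K} {f : U →ₗ[K] V}
    {g : V →ₗ[K] W} {d e : ZMod 2} (hg : HasDegree g e) (hf : HasDegree f d) :
    HasDegree (g ∘ₗ f) (d + e) := by
  intro p x hx
  rw [← add_assoc]
  exact hg _ _ (hf p x hx)

theorem equivOfEq_map_grade {V W : SuperSpace.{u, v} K} (h : V = W) {p : ZMod 2}
    (hp : V.grade p = ⊤) : W.grade p = ⊤ := by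
  subst h
  exact hp

end SuperSpace

theorem Submodule.isCompl_of_forall {K V : Type*} [Field K] [AddCommGroup V] [Module K V]
    {S T : Submodule K V} (h0 : ∀ x ∈ S, x ∈ T → x = 0) (h1 : ∀ x, ∃ y ∈ S, ∃ z ∈ T, y + z = x) :
    IsCompl S T := by
  refine ⟨Submodule.disjoint_def.2 h0, ?_⟩
  rw [codisjoint_iff, eq_top_iff]
  exact fun x _ => Submodule.mem_sup.2 (h1 x)

theorem Submodule.exists_add_of_isCompl {K V : Type*} [Field K] [AddCommGroup V] [Module K V]
    {S T : Submodule K V} (h : IsCompl S T) (x : V) : ∃ y ∈ S, ∃ z ∈ T, y + z = x :=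
  Submodule.mem_sup.1 (h.sup_eq_top ▸ Submodule.mem_top)

theorem ColouredQuiver.IsSink.ne_of_arrow {ι : Type} {Q : ColouredQuiver ι} {i j k : ι}
    (hi : Q.IsSink i) (e : Q.arrow j k) : j ≠ i := by
  rintro rfl
  exact hi k e

/-! ### Decompositions under the reflection functor -/

namespace SuperRep

variable {K : Type u} [Field K] {ι : Type} {Q : ColouredQuiver ι}

open Classical in
/-- The subrepresentation supported on a set of vertices with no nonzero map out of it. -/
noncomputable def SubRep.supported (X : SuperRep.{u, v} K Q) (s : Set ι)
    (hs : ∀ {a b : ι} (e : Q.arrow a b), a ∈ s → b ∉ s → X.map e = 0) : SubRep X where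
  space j := if j ∈ s then ⊤ else ⊥
  graded j := by
    split_ifs
    · exact SuperSpace.isGraded_top
    · exact SuperSpace.isGraded_bot
  map_mem {a b} e x hx := by
    by_cases hb : b ∈ s
    · simp [hb]
    by_cases ha : a ∈ s
    · simp [hs e ha hb]
    · simp only [if_neg ha, Submodule.mem_bot] at hx
      simp [hx]

/-- If all maps crossing between `s` and its complement vanish, `X` is the direct sum of its
restrictions to the two. The condition `a ∈ s ↔ b ∉ s` says that the arrow crosses. -/
theorem IsIndecomposable.forall_subsingleton {X : SuperRep.{u, v} K Q} (hX : X.IsIndecomposable)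
    (s : Set ι) (hs : ∀ {a b : ι} (e : Q.arrow a b), (a ∈ s ↔ b ∉ s) → X.map e = 0) :
    (∀ a ∈ s, Subsingleton (X.space a)) ∨ ∀ a ∉ s, Subsingleton (X.space a) := by
  refine (hX.2 (.supported X s fun e ha hb => hs e (by tauto))
    (.supported X sᶜ fun e ha hb => hs e (by simp_all)) fun i => ?_).imp ?_ ?_
  · by_cases hi : i ∈ s
    · simp [SubRep.supported, hi, isCompl_top_bot]
    · simp [SubRep.supported, hi, isCompl_bot_top]
  · intro h a ha
    have := h a
    simp only [SubRep.supported, if_pos ha] at this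
    exact (Submodule.subsingleton_iff K).1 (subsingleton_of_bot_eq_top this.symm)
  · intro h a ha
    have := h a
    simp only [SubRep.supported, if_pos (Set.mem_compl ha)] at this
    exact (Submodule.subsingleton_iff K).1 (subsingleton_of_bot_eq_top this.symm)

section Reflection

variable [Finite ι] {i : ι} {X : SuperRep.{u, v} K (Q.reflect i)}

theorem reflMap_reflEquiv_of_ne (hi : Q.IsSink i) {j k : ι} (hj : j ≠ i) (hk : k ≠ i)
    (e : Q.arrow j k) (e' : (Q.reflect i).arrow j k) (x : X.space j) :
    X.reflMap hi e (X.reflEquiv hj x) = X.reflEquiv hk (X.map e' x) := by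
  simp [reflMap, hk]

variable (X) in
/-- The projection of `⨁ X(k)`, over the neighbours `k` of `i`, to the space of the reflected
super-representation at `i`. -/
noncomputable def projReflSpace : (∀ k : {k // Q.arrow k i}, X.space k) →ₗ[K] X.reflSpace i where
  toFun w := SuperSpace.equivOfEq (X.reflSpace_eq rfl)
    (SuperSpace.cokerMk (outMap X) (hasDegree_outMap X) w)
  map_add' w w' := by
    rw [← map_add]
    exact congrArg _ (map_add (SuperSpace.cokerMk (outMap X) (hasDegree_outMap X)) w w')
  map_smul' c w := by
    rw [RingHom.id_apply, ← map_smul]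
    exact congrArg _ (map_smul (SuperSpace.cokerMk (outMap X) (hasDegree_outMap X)) c w)

theorem projReflSpace_surjective : Function.Surjective (projReflSpace X) := by
  intro y
  obtain ⟨w, hw⟩ := Submodule.Quotient.mk_surjective _
    ((SuperSpace.equivOfEq (X.reflSpace_eq rfl)).symm y)
  refine ⟨w, ?_⟩
  change SuperSpace.equivOfEq (X.reflSpace_eq rfl) (Submodule.Quotient.mk w) = y
  rw [hw, LinearEquiv.apply_symm_apply]

theorem projReflSpace_eq_zero_iff {w : ∀ k : {k // Q.arrow k i}, X.space k} :
    projReflSpace X w = 0 ↔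
      ∃ x : X.space i, (fun k => X.map (ColouredQuiver.reflect_arrow_left.2 k.2) x) = w := by
  change SuperSpace.equivOfEq (X.reflSpace_eq rfl) (Submodule.Quotient.mk w) = 0 ↔ _
  refine (LinearEquiv.map_eq_zero_iff _).trans ?_
  exact Submodule.Quotient.mk_eq_zero _

theorem reflMap_reflEquiv_self [inst : DecidableEq {k // Q.arrow k i}] (hi : Q.IsSink i) {j : ι}
    (hj : j ≠ i) (e : Q.arrow j i) (x : X.space j) : X.reflMap hi e (X.reflEquiv hj x) =
      projReflSpace X (Pi.single (M := fun k : {k // Q.arrow k i} => X.space k) ⟨j, e⟩ x) := by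
  simp only [reflMap, dif_pos, LinearMap.comp_apply, LinearEquiv.coe_coe,
    LinearEquiv.symm_apply_apply]
  refine congrArg (SuperSpace.equivOfEq (X.reflSpace_eq rfl))
    (congrArg (SuperSpace.cokerMk (outMap X) (hasDegree_outMap X)) ?_)
  obtain rfl : inst = fun a b => Classical.propDecidable (a = b) := Subsingleton.elim _ _
  rfl

/-- The spaces of a subrepresentation of a reflected super-representation. -/
def SubRep.reflSub {hi : Q.IsSink i} (U : SubRep (superReflection hi X)) (j : ι) :
    Submodule K (X.reflSpace j) := U.space j

theorem SubRep.reflMap_mem {hi : Q.IsSink i} (U : SubRep (superReflection hi X)) {j k : ι}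
    (e : Q.arrow j k) {x : X.reflSpace j} (hx : x ∈ U.reflSub j) : X.reflMap hi e x ∈ U.reflSub k :=
  U.map_mem e x hx

theorem SubRep.projReflSpace_mem {hi : Q.IsSink i} (U : SubRep (superReflection hi X))
    {w : ∀ k : {k // Q.arrow k i}, X.space k}
    (hw : ∀ (k : {k // Q.arrow k i}) (hk : k.1 ≠ i), X.reflEquiv hk (w k) ∈ U.reflSub k) :
    projReflSpace X w ∈ U.reflSub i := by
  classical
  have := Fintype.ofFinite {k // Q.arrow k i}
  rw [← Finset.univ_sum_single w, map_sum]
  refine Submodule.sum_mem _ fun k _ => ?_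
  have hk : k.1 ≠ i := hi.ne_of_arrow k.2
  have := U.reflMap_mem k.2 (hw k hk)
  rwa [reflMap_reflEquiv_self] at this

open Classical in
theorem hasDegree_reflEquiv {j : ι} (h : j ≠ i) :
    SuperSpace.HasDegree (X.reflEquiv h).toLinearMap (if Q.arrow j i then Q.colour i else 0) := by
  intro p x hx
  refine X.reflEquiv_mem h ?_ hx
  have : ∀ p c : ZMod 2, p = p + c + c := by decide
  exact this _ _

/-- The subrepresentation of `X` induced by a subrepresentation of its reflection. -/
noncomputable def SubRep.ofReflection {hi : Q.IsSink i} (U : SubRep (superReflection hi X)) :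
    SubRep X where
  -- One formula for all vertices: at `i` the first infimum is empty, hence `⊤`; elsewhere the
  -- second condition follows from the first. Gradedness then needs no case distinction.
  space j := (⨅ h : j ≠ i, (U.reflSub j).comap (X.reflEquiv h).toLinearMap) ⊓
    ⨅ (k : ι) (hk : k ≠ i) (e : (Q.reflect i).arrow j k),
      (U.reflSub k).comap ((X.reflEquiv hk).toLinearMap ∘ₗ X.map e)
  graded j := by
    refine SuperSpace.IsGraded.inf (.iInf fun h => .comap (hasDegree_reflEquiv h) (U.graded j))
      (.iInf fun k => .iInf fun hk => .iInf fun e =>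
        .comap ((hasDegree_reflEquiv hk).comp (X.hasDegree_map e)) (U.graded k))
  map_mem {a b} e x hx := by
    have hx2 := (Submodule.mem_inf.1 hx).2
    simp only [Submodule.mem_inf, Submodule.mem_iInf, Submodule.mem_comap] at hx2 ⊢
    refine ⟨fun h => hx2 b h e, fun k hk e' => ?_⟩
    have hb : b ≠ i := by
      rintro rfl
      exact hi.isSource_reflect a e
    have := U.reflMap_mem ((ColouredQuiver.reflect_arrow_of_ne hb hk).1 e') (hx2 b hb e)
    rwa [LinearMap.comp_apply, LinearEquiv.coe_coe, reflMap_reflEquiv_of_ne hi hb hk _ e'] at this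

theorem SubRep.mem_ofReflection_of_ne {hi : Q.IsSink i} (U : SubRep (superReflection hi X)) {j : ι}
    (hj : j ≠ i) {x : X.space j} :
    x ∈ U.ofReflection.space j ↔ X.reflEquiv hj x ∈ U.reflSub j := by
  simp only [ofReflection, Submodule.mem_inf, Submodule.mem_iInf, Submodule.mem_comap]
  refine ⟨fun h => h.1 hj, fun h => ⟨fun _ => h, fun k hk e => ?_⟩⟩
  have := U.reflMap_mem ((ColouredQuiver.reflect_arrow_of_ne hj hk).1 e) h
  rwa [reflMap_reflEquiv_of_ne hi hj hk _ e] at this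

theorem SubRep.mem_ofReflection_self {hi : Q.IsSink i} (U : SubRep (superReflection hi X))
    {x : X.space i} : x ∈ U.ofReflection.space i ↔ ∀ (k : {k // Q.arrow k i}) (hk : k.1 ≠ i),
      X.reflEquiv hk (X.map (ColouredQuiver.reflect_arrow_left.2 k.2) x) ∈ U.reflSub k := by
  simp only [ofReflection, Submodule.mem_inf, Submodule.mem_iInf, Submodule.mem_comap]
  exact ⟨fun h k hk => h.2 k hk _,
    fun h => ⟨fun h => absurd rfl h,
      fun k hk e => h ⟨k, ColouredQuiver.reflect_arrow_left.1 e⟩ hk⟩⟩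

/-- Only vertex `i` is delicate. Split the images of `x` in the neighbouring spaces along `U` and
`W`. The classes of the two parts in the cokernel are opposite and lie in complementary subspaces,
so both vanish. Both parts therefore come from `X(i)`, and injectivity makes their preimages sum to
`x`. -/
theorem SubRep.isCompl_ofReflection {hi : Q.IsSink i} (hinj : Function.Injective (outMap X))
    {U W : SubRep (superReflection hi X)} (h : ∀ j, IsCompl (U.space j) (W.space j)) (j : ι) :
    IsCompl (U.ofReflection.space j) (W.ofReflection.space j) := by
  have h' : ∀ j, IsCompl (U.reflSub j) (W.reflSub j) := h
  have hne : ∀ k : {k // Q.arrow k i}, k.1 ≠ i := fun k => hi.ne_of_arrow k.2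
  have disj : ∀ {j : ι} {x : X.reflSpace j}, x ∈ U.reflSub j → x ∈ W.reflSub j → x = 0 :=
    fun {j x} => Submodule.disjoint_def.1 (h' j).disjoint x
  by_cases hj : j = i
  · subst hj
    refine Submodule.isCompl_of_forall (fun x hU hW => ?_) fun x => ?_
    · rw [mem_ofReflection_self] at hU hW
      apply hinj
      rw [map_zero]
      funext k
      exact (LinearEquiv.map_eq_zero_iff _).1 (disj (hU k (hne k)) (hW k (hne k)))
    · have hx : ∀ k : {k // Q.arrow k j}, ∃ y z : X.space k,
          X.reflEquiv (hne k) y ∈ U.reflSub k ∧ X.reflEquiv (hne k) z ∈ W.reflSub k ∧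
          y + z = X.map (ColouredQuiver.reflect_arrow_left.2 k.2) x := fun k => by
        obtain ⟨y, hy, z, hz, hyz⟩ := Submodule.exists_add_of_isCompl (h' k)
          (X.reflEquiv (hne k) (X.map (ColouredQuiver.reflect_arrow_left.2 k.2) x))
        refine ⟨(X.reflEquiv (hne k)).symm y, (X.reflEquiv (hne k)).symm z, by simpa using hy,
          by simpa using hz, ?_⟩
        rw [← map_add, hyz, LinearEquiv.symm_apply_apply]
      choose y z hy hz hyz using hx
      have hsum : projReflSpace X y + projReflSpace X z = 0 := by
        rw [← map_add]
        exact projReflSpace_eq_zero_iff.2 ⟨x, funext fun k => (hyz k).symm⟩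
      have hyU := U.projReflSpace_mem fun k hk => hy k
      have hzW := W.projReflSpace_mem fun k hk => hz k
      have hy0 : projReflSpace X y = 0 := by
        refine disj hyU ?_
        rw [eq_neg_of_add_eq_zero_left hsum]
        exact neg_mem hzW
      rw [hy0, zero_add] at hsum
      obtain ⟨a, ha⟩ := projReflSpace_eq_zero_iff.1 hy0
      obtain ⟨b, hb⟩ := projReflSpace_eq_zero_iff.1 hsum
      refine ⟨a, U.mem_ofReflection_self.2 fun k hk => ?_, b,
        W.mem_ofReflection_self.2 fun k hk => ?_, hinj ?_⟩
      · exact congrFun ha k ▸ hy k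
      · exact congrFun hb k ▸ hz k
      · rw [map_add]
        funext k
        refine Eq.trans ?_ (hyz k)
        rw [← ha, ← hb]
        rfl
  · refine Submodule.isCompl_of_forall (fun x hU hW => ?_) fun x => ?_
    · rw [mem_ofReflection_of_ne _ hj] at hU hW
      exact (LinearEquiv.map_eq_zero_iff _).1 (disj hU hW)
    · obtain ⟨y, hy, z, hz, hyz⟩ := Submodule.exists_add_of_isCompl (h' j) (X.reflEquiv hj x)
      refine ⟨(X.reflEquiv hj).symm y, ?_, (X.reflEquiv hj).symm z, ?_, ?_⟩
      · rw [mem_ofReflection_of_ne _ hj, LinearEquiv.apply_symm_apply]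
        exact hy
      · rw [mem_ofReflection_of_ne _ hj, LinearEquiv.apply_symm_apply]
        exact hz
      · rw [← map_add, hyz, LinearEquiv.symm_apply_apply]

/-- Away from `i`, `U` vanishes and so `W` is everything. As the neighbours span the cokernel, `W`
is everything at `i` too. -/
theorem SubRep.eq_bot_of_ofReflection {hi : Q.IsSink i} {U W : SubRep (superReflection hi X)}
    (h : ∀ j, IsCompl (U.space j) (W.space j)) (hU : ∀ j, U.ofReflection.space j = ⊥) (j : ι) :
    U.space j = ⊥ := by
  have hne : ∀ j, j ≠ i → U.reflSub j = ⊥ := fun j hj => by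
    refine (Submodule.eq_bot_iff _).2 fun x hx => ?_
    have hx' : (X.reflEquiv hj).symm x ∈ U.ofReflection.space j := by
      rwa [mem_ofReflection_of_ne _ hj, LinearEquiv.apply_symm_apply]
    rw [hU j, Submodule.mem_bot] at hx'
    exact (LinearEquiv.map_eq_zero_iff _).1 hx'
  have h' : ∀ j, IsCompl (U.reflSub j) (W.reflSub j) := h
  by_cases hj : j = i
  · subst hj
    refine (Submodule.eq_bot_iff _).2 fun x hx => ?_
    obtain ⟨w, rfl⟩ := projReflSpace_surjective (X := X) x
    refine Submodule.disjoint_def.1 (h' j).disjoint _ hx (W.projReflSpace_mem fun k hk => ?_)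
    have := (h' k).sup_eq_top
    rw [hne k hk, bot_sup_eq] at this
    rw [this]
    exact Submodule.mem_top
  · exact hne j hj

/-- The super reflection functor preserves indecomposability, except for the simple
super-representation at the reflected vertex. -/
theorem IsIndecomposable.superReflection (hi : Q.IsSink i) (hX : X.IsIndecomposable)
    (hinj : Function.Injective (outMap X)) (hne : ∃ j ≠ i, Nontrivial (X.space j)) :
    (X.superReflection hi).IsIndecomposable := by
  constructor
  · obtain ⟨j, hj, hX⟩ := hne
    exact ⟨j, (X.reflEquiv hj).symm.toEquiv.nontrivial⟩
  · intro U W h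
    exact (hX.2 _ _ (SubRep.isCompl_ofReflection hinj h)).imp
      (SubRep.eq_bot_of_ofReflection h) (SubRep.eq_bot_of_ofReflection fun j => (h j).symm)

/-- In dimension at most `1` a nonzero kernel is all of `X(i)`; then every arrow out of the source
`i` acts by zero and `X(i)` splits off. -/
theorem IsIndecomposable.outMap_injective (hi : Q.IsSink i) (hX : X.IsIndecomposable)
    (hdim : X.dimVec i ≤ 1) (hne : ∃ j ≠ i, Nontrivial (X.space j)) :
    Function.Injective (outMap X) := by
  rw [← LinearMap.ker_eq_bot]
  by_contra hker
  have hpos : 0 < Module.finrank K (LinearMap.ker (outMap X)) :=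
    Nat.pos_of_ne_zero fun h => hker (Submodule.finrank_eq_zero.1 h)
  have hle := Submodule.finrank_le (LinearMap.ker (outMap X))
  have htop : LinearMap.ker (outMap X) = ⊤ :=
    Submodule.eq_top_of_finrank_eq (by rw [dimVec] at hdim; omega)
  have hnt : Nontrivial (X.space i) :=
    Module.nontrivial_of_finrank_pos (R := K) (hpos.trans_le hle)
  obtain ⟨j, hj, hjn⟩ := hne
  have hzero : ∀ {a b : ι} (e : (Q.reflect i).arrow a b), (a ∈ ({i} : Set ι) ↔ b ∉ ({i} : Set ι)) →
      X.map e = 0 := by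
    intro a b e hab
    have hb : b ≠ i := by
      rintro rfl
      exact hi.isSource_reflect a e
    obtain rfl : a = i := hab.2 hb
    refine LinearMap.ext fun x => ?_
    have hx : x ∈ LinearMap.ker (outMap X) := htop ▸ Submodule.mem_top
    have hx0 : outMap X x = 0 := hx
    exact congrFun hx0 ⟨b, ColouredQuiver.reflect_arrow_left.1 e⟩
  rcases hX.forall_subsingleton {i} hzero with h | h
  · exact not_subsingleton_iff_nontrivial.2 hnt (h i rfl)
  · exact not_subsingleton_iff_nontrivial.2 hjn (h j hj)

theorem dimVec_superReflection_of_ne (hi : Q.IsSink i) {j : ι} (hj : j ≠ i) :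
    (X.superReflection hi).dimVec j = X.dimVec j :=
  (X.reflEquiv hj).symm.finrank_eq

theorem dimVec_superReflection_self (hi : Q.IsSink i) (hinj : Function.Injective (outMap X))
    [Fintype {k // Q.arrow k i}] :
    (X.superReflection hi).dimVec i + X.dimVec i = ∑ k : {k // Q.arrow k i}, X.dimVec k := by
  have h1 : (X.superReflection hi).dimVec i = Module.finrank K
      ((SuperSpace.directSum fun k : {k // Q.arrow k i} =>
      (X.space k).shift ((Q.reflect i).colour i + (Q.reflect i).colour k)) ⧸
        LinearMap.range (outMap X)) :=
    (SuperSpace.equivOfEq (X.reflSpace_eq rfl)).symm.finrank_eq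
  have h2 : X.dimVec i = Module.finrank K (LinearMap.range (outMap X)) :=
    (LinearMap.finrank_range_of_inj hinj).symm
  rw [h1, h2, Submodule.finrank_quotient_add_finrank]
  exact Module.finrank_pi_fintype K (M := fun k : {k // Q.arrow k i} => X.space k)

/-- If the space at every vertex is pure of the parity given by the colour of that vertex, then
the same holds after a super reflection. -/
theorem grade_colour_superReflection (hi : Q.IsSink i)
    (h : ∀ j, (X.space j).grade ((Q.reflect i).colour j) = ⊤) (j : ι) :
    ((X.superReflection hi).space j).grade (Q.colour j) = ⊤ := by
  by_cases hj : j = i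
  · subst hj
    refine SuperSpace.equivOfEq_map_grade (X.reflSpace_eq rfl) ?_
    rw [eq_top_iff]
    intro y _
    obtain ⟨w, rfl⟩ : ∃ w : ∀ k : {k // Q.arrow k j}, X.space k,
        SuperSpace.cokerMk (outMap X) (hasDegree_outMap X) w = y :=
      Submodule.Quotient.mk_surjective _ y
    refine ⟨w, fun k _ => ?_, rfl⟩
    -- A sink keeps its own colour, so the shift by `p(i) + p(k)` moves each summand from parity
    -- `p(k)` to parity `p(i)`.
    have hc : Q.colour j + ((Q.reflect j).colour j + (Q.reflect j).colour k) =
        (Q.reflect j).colour k := by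
      rw [hi.reflect_colour j, if_neg (hi j), add_zero, ← add_assoc, CharTwo.add_self_eq_zero,
        zero_add]
    change w k ∈ (X.space k).grade _
    rw [hc, h]
    exact Submodule.mem_top
  · classical
    refine SuperSpace.equivOfEq_map_grade (X.reflSpace_ne hj) ?_
    have := h j
    rw [hi.reflect_colour] at this
    exact this

end Reflection

theorem grade_simple (Q : ColouredQuiver ι) (i j : ι) :
    ((simple K Q i (Q.colour i)).space j).grade (Q.colour j) = ⊤ := by
  by_cases h : j = i
  · subst h
    refine SuperSpace.equivOfEq_map_grade (V := SuperSpace.line K (Q.colour j))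
      (by simp [simple]) ?_
    exact if_pos rfl
  · refine SuperSpace.equivOfEq_map_grade (V := SuperSpace.zero K) (by simp [simple, h]) rfl

open Classical in
theorem dimVec_simple (Q : ColouredQuiver ι) (i j : ι) (p : ZMod 2) :
    (simple K Q i p).dimVec j = if j = i then 1 else 0 := by
  split_ifs with h
  · rw [dimVec, ← (SuperSpace.equivOfEq (V := SuperSpace.line K p)
      (by simp [simple, h])).finrank_eq]
    exact Module.finrank_self K
  · rw [dimVec, ← (SuperSpace.equivOfEq (V := SuperSpace.zero K)
      (by simp [simple, h])).finrank_eq]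
    exact Module.finrank_zero_of_subsingleton (R := K) (M := PUnit.{u + 1})

theorem isIndecomposable_of_dimVec [DecidableEq ι] {X : SuperRep.{u, v} K Q} {i : ι}
    (h : ∀ j, X.dimVec j = if j = i then 1 else 0) : X.IsIndecomposable := by
  have hs : ∀ j, j ≠ i → ∀ U : Submodule K (X.space j), U = ⊥ := fun j hj U => by
    have := h j
    rw [if_neg hj] at this
    have := (Module.finrank_zero_iff (R := K) (M := X.space j)).1 this
    exact Subsingleton.elim _ _
  have hone : Module.finrank K (X.space i) = 1 := by simpa [dimVec] using h i
  have hnt : Nontrivial (X.space i) := Module.nontrivial_of_finrank_pos (R := K) (by omega)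
  refine ⟨⟨i, hnt⟩, fun U W hUW => ?_⟩
  have hadd := Submodule.finrank_add_eq_of_isCompl (hUW i)
  have : U.space i = ⊥ ∨ W.space i = ⊥ := by
    rw [← Submodule.finrank_eq_zero, ← Submodule.finrank_eq_zero (S := W.space i)]
    omega
  refine this.imp (fun h j => ?_) fun h j => ?_
  all_goals
    by_cases hj : j = i
    · subst hj
      exact h
    · exact hs j hj _

end SuperRep

/-! ### Spaces of dimension at most one and uniqueness over a path -/

namespace SuperSpace

variable {K : Type u} [Field K]

/-- A graded space of dimension at most `1` is purely even or purely odd. -/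
theorem exists_grade_eq_top (V : SuperSpace.{u, v} K) (h : Module.finrank K V ≤ 1) :
    ∃ p, V.grade p = ⊤ := by
  have hadd := Submodule.finrank_add_eq_of_isCompl V.isCompl
  have hsup := V.isCompl.sup_eq_top
  have : Module.finrank K (V.grade 0) = 0 ∨ Module.finrank K (V.grade 1) = 0 := by omega
  rcases this with h0 | h0
  · rw [Submodule.finrank_eq_zero.1 h0, bot_sup_eq] at hsup
    exact ⟨1, hsup⟩
  · rw [Submodule.finrank_eq_zero.1 h0, sup_bot_eq] at hsup
    exact ⟨0, hsup⟩

/-- Makes homogeneity automatic for the isomorphisms constructed below. -/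
theorem hasDegree_of_grade_eq_top {V : SuperSpace.{u, v} K} {W : SuperSpace.{u, w} K}
    {p q : ZMod 2} (hp : V.grade p = ⊤) (hq : W.grade q = ⊤) (f : V →ₗ[K] W) :
    HasDegree f (p + q) := by
  intro r x hx
  have h2 : ∀ p r : ZMod 2, r = p ∨ r = p + 1 := by decide
  rcases h2 p r with rfl | rfl
  · rw [← add_assoc, CharTwo.add_self_eq_zero, zero_add, hq]
    exact Submodule.mem_top
  · have hx0 := Submodule.disjoint_def.1 (V.isCompl_add p).disjoint x (hp ▸ Submodule.mem_top) hx
    rw [hx0, map_zero]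
    exact Submodule.zero_mem _

end SuperSpace

section Extension

variable {K : Type*} [Field K] {V W V' W' : Type*}
  [AddCommGroup V] [Module K V] [AddCommGroup W] [Module K W]
  [AddCommGroup V'] [Module K V'] [AddCommGroup W'] [Module K W']

theorem LinearMap.bijective_of_finrank_eq_one {f : V →ₗ[K] W} (hV : Module.finrank K V = 1)
    (hW : Module.finrank K W = 1) (hf : f ≠ 0) : Function.Bijective f := by
  have := isSimpleModule_iff_finrank_eq_one.2 hV
  have := isSimpleModule_iff_finrank_eq_one.2 hW
  exact f.bijective_or_eq_zero.resolve_right hf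

/-- An isomorphism between the sources of two maps of spaces of dimension at most `1` extends to
the targets. -/
theorem LinearEquiv.exists_extend_target [FiniteDimensional K V] [FiniteDimensional K W]
    [FiniteDimensional K W'] {f : V →ₗ[K] W} {g : V' →ₗ[K] W'}
    (hV : Module.finrank K V ≤ 1) (hW : Module.finrank K W ≤ 1)
    (hW' : Module.finrank K W = Module.finrank K W')
    (hf : Nontrivial V → Nontrivial W → f ≠ 0) (hg : Nontrivial V' → Nontrivial W' → g ≠ 0)
    (φ : V ≃ₗ[K] V') : ∃ ψ : W ≃ₗ[K] W', ∀ x, ψ (f x) = g (φ x) := by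
  rcases subsingleton_or_nontrivial V with hV0 | hV0
  · refine ⟨LinearEquiv.ofFinrankEq _ _ hW', fun x => ?_⟩
    rw [Subsingleton.elim x 0]
    simp
  rcases subsingleton_or_nontrivial W with hW0 | hW0
  · have : Subsingleton W' := (LinearEquiv.ofFinrankEq W W' hW').symm.toEquiv.subsingleton
    exact ⟨LinearEquiv.ofFinrankEq _ _ hW', fun x => Subsingleton.elim _ _⟩
  have hV0' : Nontrivial V' := φ.symm.toEquiv.nontrivial
  have hW0' : Nontrivial W' := (LinearEquiv.ofFinrankEq W W' hW').symm.toEquiv.nontrivial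
  have hV1 : Module.finrank K V = 1 := le_antisymm hV Module.finrank_pos
  have hW1 : Module.finrank K W = 1 := le_antisymm hW Module.finrank_pos
  have hfb := LinearMap.bijective_of_finrank_eq_one hV1 hW1 (hf hV0 hW0)
  have hgb := LinearMap.bijective_of_finrank_eq_one (φ.finrank_eq ▸ hV1) (hW' ▸ hW1)
    (hg hV0' hW0')
  refine ⟨(LinearEquiv.ofBijective f hfb).symm ≪≫ₗ φ ≪≫ₗ LinearEquiv.ofBijective g hgb,
    fun x => ?_⟩
  have : (LinearEquiv.ofBijective f hfb).symm (f x) = x :=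
    (LinearEquiv.ofBijective f hfb).symm_apply_apply x
  simp [this]

/-- An isomorphism between the targets of two maps of spaces of dimension at most `1` extends to
the sources. -/
theorem LinearEquiv.exists_extend_source [FiniteDimensional K V] [FiniteDimensional K W]
    [FiniteDimensional K V'] {f : V →ₗ[K] W} {g : V' →ₗ[K] W'}
    (hV : Module.finrank K V ≤ 1) (hW : Module.finrank K W ≤ 1)
    (hV' : Module.finrank K V = Module.finrank K V')
    (hf : Nontrivial V → Nontrivial W → f ≠ 0) (hg : Nontrivial V' → Nontrivial W' → g ≠ 0)
    (ψ : W ≃ₗ[K] W') : ∃ φ : V ≃ₗ[K] V', ∀ x, ψ (f x) = g (φ x) := by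
  rcases subsingleton_or_nontrivial V with hV0 | hV0
  · refine ⟨LinearEquiv.ofFinrankEq _ _ hV', fun x => ?_⟩
    rw [Subsingleton.elim x 0]
    simp
  rcases subsingleton_or_nontrivial W with hW0 | hW0
  · have : Subsingleton W' := ψ.symm.toEquiv.subsingleton
    exact ⟨LinearEquiv.ofFinrankEq _ _ hV', fun x => Subsingleton.elim _ _⟩
  have hV0' : Nontrivial V' := (LinearEquiv.ofFinrankEq V V' hV').symm.toEquiv.nontrivial
  have hW0' : Nontrivial W' := ψ.symm.toEquiv.nontrivial
  have hV1 : Module.finrank K V = 1 := le_antisymm hV Module.finrank_pos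
  have hW1 : Module.finrank K W = 1 := le_antisymm hW Module.finrank_pos
  have hfb := LinearMap.bijective_of_finrank_eq_one hV1 hW1 (hf hV0 hW0)
  have hgb := LinearMap.bijective_of_finrank_eq_one (hV' ▸ hV1) (ψ.finrank_eq ▸ hW1)
    (hg hV0' hW0')
  refine ⟨LinearEquiv.ofBijective f hfb ≪≫ₗ ψ ≪≫ₗ (LinearEquiv.ofBijective g hgb).symm,
    fun x => ?_⟩
  exact ((LinearEquiv.ofBijective g hgb).apply_symm_apply (ψ (f x))).symm

end Extension

namespace SuperRep

variable {K : Type u} [Field K] {ι : Type} {Q : ColouredQuiver ι} {pos : ι → ℕ}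

/-- In an indecomposable super-representation of a path, the maps between nonzero spaces are
nonzero. -/
theorem IsIndecomposable.map_ne_zero {X : SuperRep.{u, v} K Q} (hX : X.IsIndecomposable)
    (hpos : Function.Injective pos)
    (hadj : ∀ i j, Q.arrow i j → pos i = pos j + 1 ∨ pos j = pos i + 1)
    (hasymm : ∀ i j, Q.arrow i j → ¬ Q.arrow j i) {i j : ι} (e : Q.arrow i j)
    (hi : Nontrivial (X.space i)) (hj : Nontrivial (X.space j)) : X.map e ≠ 0 := by
  intro h0
  -- Cut the path at the edge of `e`. The only arrow across the cut is `e`, so if its map vanished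
  -- `X` would split with a nonzero space on each side.
  have hcut : ∀ {a b : ι} (e' : Q.arrow a b),
      (a ∈ {k | pos k ≤ min (pos i) (pos j)} ↔ b ∉ {k | pos k ≤ min (pos i) (pos j)}) →
      X.map e' = 0 := by
    intro a b e' hab
    simp only [Set.mem_ofPred_eq] at hab
    have h1 := hadj _ _ e
    have h2 := hadj _ _ e'
    have : (pos a = pos i ∧ pos b = pos j) ∨ (pos a = pos j ∧ pos b = pos i) := by omega
    rcases this with ⟨ha, hb⟩ | ⟨ha, hb⟩
    · obtain rfl := hpos ha
      obtain rfl := hpos hb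
      exact h0
    · obtain rfl := hpos ha
      obtain rfl := hpos hb
      exact absurd e' (hasymm _ _ e)
  have h1 := hadj _ _ e
  rcases hX.forall_subsingleton _ hcut with h | h
  · rcases h1 with h1 | h1
    · exact not_subsingleton_iff_nontrivial.2 hj (h j (by simp [h1]))
    · exact not_subsingleton_iff_nontrivial.2 hi (h i (by simp [h1]))
  · rcases h1 with h1 | h1
    · exact not_subsingleton_iff_nontrivial.2 hi (h i (by simp [h1]))
    · exact not_subsingleton_iff_nontrivial.2 hj (h j (by simp [h1]))

/-- Over a path, indecomposable super-representations with the same dimension vector, all of whose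
entries are at most `1`, are isomorphic. -/
theorem IsIndecomposable.isomorphic [Fintype ι] {X : SuperRep.{u, v} K Q}
    {Y : SuperRep.{u, w} K Q} (hX : X.IsIndecomposable) (hY : Y.IsIndecomposable)
    (hpos : Function.Injective pos)
    (hadj : ∀ i j, Q.arrow i j → pos i = pos j + 1 ∨ pos j = pos i + 1)
    (hasymm : ∀ i j, Q.arrow i j → ¬ Q.arrow j i)
    (hdim : X.dimVec = Y.dimVec) (hle : ∀ i, X.dimVec i ≤ 1) : X.Isomorphic Y := by
  classical
  have hXY : ∀ i, Module.finrank K (X.space i) = Module.finrank K (Y.space i) := congrFun hdim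
  have hX0 := fun {i j} (e : Q.arrow i j) => hX.map_ne_zero hpos hadj hasymm e
  have hY0 := fun {i j} (e : Q.arrow i j) => hY.map_ne_zero hpos hadj hasymm e
  have key : ∀ s : Finset ι, ∃ φ : ∀ i, X.space i ≃ₗ[K] Y.space i,
      ∀ i ∈ s, ∀ j ∈ s, ∀ (e : Q.arrow i j) x, φ j (X.map e x) = Y.map e (φ i x) := by
    intro s
    -- Vertices are added in order of position, so a new one has at most one neighbour among the old
    -- ones and imposes at most one commutation condition.
    induction s using Finset.induction_on_max_value pos with
    | empty => exact ⟨fun i => LinearEquiv.ofFinrankEq _ _ (hXY i), by simp⟩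
    | insert a s ha hmax ih =>
      obtain ⟨φ, hφ⟩ := ih
      have huniq : ∀ k ∈ s, ∀ k' ∈ s, (Q.arrow k a ∨ Q.arrow a k) →
          (Q.arrow k' a ∨ Q.arrow a k') → k = k' := by
        intro k hk k' hk' h h'
        have h1 := hmax k hk
        have h2 := hmax k' hk'
        have h3 := h.elim (hadj _ _) fun e => (hadj _ _ e).symm
        have h4 := h'.elim (hadj _ _) fun e => (hadj _ _ e).symm
        exact hpos (by omega)
      obtain ⟨ψ, hψ⟩ : ∃ ψ : X.space a ≃ₗ[K] Y.space a, ∀ k ∈ s,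
          (∀ (e : Q.arrow k a) x, ψ (X.map e x) = Y.map e (φ k x)) ∧
          ∀ (e : Q.arrow a k) x, φ k (X.map e x) = Y.map e (ψ x) := by
        by_cases hk : ∃ k ∈ s, Q.arrow k a ∨ Q.arrow a k
        · obtain ⟨k, hks, e | e⟩ := hk
          · obtain ⟨ψ, hψ⟩ := LinearEquiv.exists_extend_target (hle k) (hle a) (hXY a) (hX0 e)
              (hY0 e) (φ k)
            refine ⟨ψ, fun k' hk' => ⟨fun e' => ?_, fun e' => ?_⟩⟩
            · obtain rfl := huniq k hks k' hk' (Or.inl e) (Or.inl e')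
              exact hψ
            · obtain rfl := huniq k hks k' hk' (Or.inl e) (Or.inr e')
              exact absurd e' (hasymm _ _ e)
          · obtain ⟨ψ, hψ⟩ := LinearEquiv.exists_extend_source (hle a) (hle k) (hXY a) (hX0 e)
              (hY0 e) (φ k)
            refine ⟨ψ, fun k' hk' => ⟨fun e' => ?_, fun e' => ?_⟩⟩
            · obtain rfl := huniq k hks k' hk' (Or.inr e) (Or.inl e')
              exact absurd e' (hasymm _ _ e)
            · obtain rfl := huniq k hks k' hk' (Or.inr e) (Or.inr e')
              exact hψ
        · push Not at hk
          exact ⟨LinearEquiv.ofFinrankEq _ _ (hXY a), fun k hks =>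
            ⟨fun e => absurd e (hk k hks).1, fun e => absurd e (hk k hks).2⟩⟩
      refine ⟨Function.update φ a ψ, fun i hi j hj e x => ?_⟩
      have hne : ∀ k ∈ s, k ≠ a := fun k hk h => ha (h ▸ hk)
      rcases Finset.mem_insert.1 hi with rfl | hi' <;> rcases Finset.mem_insert.1 hj with rfl | hj'
      · exact absurd e (hasymm _ _ e)
      · rw [Function.update_self, Function.update_of_ne (hne j hj')]
        exact (hψ j hj').2 e x
      · rw [Function.update_self, Function.update_of_ne (hne i hi')]
        exact (hψ i hi').1 e x
      · rw [Function.update_of_ne (hne i hi'), Function.update_of_ne (hne j hj')]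
        exact hφ i hi' j hj' e x
  obtain ⟨φ, hφ⟩ := key Finset.univ
  -- The degree may vary with the vertex, as the definition of a morphism allows.
  choose p hp using fun i => (X.space i).exists_grade_eq_top (hle i)
  choose q hq using fun i => (Y.space i).exists_grade_eq_top ((hXY i).symm.trans_le (hle i))
  refine ⟨⟨fun i => (φ i).toLinearMap,
      fun i => ⟨_, SuperSpace.hasDegree_of_grade_eq_top (hp i) (hq i) _⟩,
      fun {i j} e => LinearMap.ext fun x => hφ i (Finset.mem_univ i) j (Finset.mem_univ j) e x⟩,
    ⟨fun i => (φ i).symm.toLinearMap,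
      fun i => ⟨_, SuperSpace.hasDegree_of_grade_eq_top (hq i) (hp i) _⟩,
      fun {i j} e => LinearMap.ext fun x => ?_⟩, fun i => ⟨?_, ?_⟩⟩
  · have := hφ i (Finset.mem_univ i) j (Finset.mem_univ j) e ((φ i).symm x)
    rw [LinearEquiv.apply_symm_apply] at this
    exact (LinearEquiv.symm_apply_eq _).2 this.symm
  · exact LinearMap.ext fun x => (φ i).symm_apply_apply x
  · exact LinearMap.ext fun x => (φ i).apply_symm_apply x

end SuperRep

/-! ### Dimension vectors along the word, and the theorem -/

theorem IsOrientation.reflect {ι : Type} {G : SimpleGraph ι} {Q : ColouredQuiver ι}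
    (h : IsOrientation G Q.arrow) (i : ι) : IsOrientation G (Q.reflect i).arrow := by
  refine ⟨fun j k => ?_, fun j k hjk => ?_⟩
  · rw [h.1]
    by_cases hj : j = i ∨ k = i
    · simp [ColouredQuiver.reflect, hj, hj.symm, or_comm]
    · simp [ColouredQuiver.reflect, hj, mt Or.symm hj]
  · by_cases hj : j = i ∨ k = i
    · simp only [ColouredQuiver.reflect, hj, hj.symm, if_true] at hjk ⊢
      exact h.2 _ _ hjk
    · simp only [ColouredQuiver.reflect, hj, mt Or.symm hj, if_false] at hjk ⊢
      exact h.2 _ _ hjk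

namespace SuperRep

variable {K : Type u} [Field K] {n m : ℕ} {ι : Type} [Fintype ι] {S : SimpleSystem n m ι}

/-- The super reflection functor acts on dimension vectors by the simple reflection. -/
theorem sum_dimVec_superReflection {Q : ColouredQuiver ι}
    (hQ : IsOrientation S.dynkinGraph Q.arrow) {i : ι} (hi : Q.IsSink i)
    {X : SuperRep.{u, v} K (Q.reflect i)} (hinj : Function.Injective (outMap X)) :
    ∑ j, (X.superReflection hi).dimVec j • S.root j =
      S.simpleReflection i (∑ j, X.dimVec j • S.root j) := by
  classical
  have hadj : ∀ j, S.dynkinGraph.Adj j i ↔ Q.arrow j i := fun j => by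
    rw [hQ.1]
    exact or_iff_left (hi j)
  -- The pairing is `2 dim X(i)` minus the sum of the dimensions at the neighbours; that sum is `dim
  -- X(i)` plus the dimension of the cokernel.
  have hdot : (∑ j, X.dimVec j • S.root j) ⬝ᵥ S.root i =
      (X.dimVec i : ℤ) - (X.superReflection hi).dimVec i := by
    have hself : (X.superReflection hi).dimVec i + X.dimVec i =
        ∑ j, if Q.arrow j i then X.dimVec j else 0 := by
      rw [dimVec_superReflection_self hi hinj, ← Finset.sum_filter]
      exact (Finset.sum_subtype _ (by simp) X.dimVec).symm
    have hterm : ∀ j, (X.dimVec j • S.root j) ⬝ᵥ S.root i =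
        (if j = i then 2 * (X.dimVec i : ℤ) else 0) -
          ((if Q.arrow j i then X.dimVec j else 0 : ℕ) : ℤ) := fun j => by
      rw [smul_dotProduct]
      by_cases hj : j = i
      · subst hj
        rw [(S.isRoot j).dotProduct_self, if_pos rfl, if_neg (hi j)]
        simp [mul_comm]
      · rw [SimpleSystem.dotProduct_root_of_ne hj, if_neg hj]
        simp only [hadj]
        split_ifs <;> simp
    rw [sum_dotProduct, Finset.sum_congr rfl fun j _ => hterm j, Finset.sum_sub_distrib,
      ← Nat.cast_sum, ← hself]
    simp only [Finset.sum_ite_eq', Finset.mem_univ, if_true, Nat.cast_add]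
    ring
  rw [S.simpleReflection_apply, hdot, ← Finset.add_sum_erase _ _ (Finset.mem_univ i),
    ← Finset.add_sum_erase (a := i) _ (fun j => X.dimVec j • S.root j) (Finset.mem_univ i),
    Finset.sum_congr rfl fun j hj => by
      rw [dimVec_superReflection_of_ne hi (Finset.ne_of_mem_erase hj)]]
  simp only [← natCast_zsmul]
  module

/-- The suffixes `t` of the word give the intermediate objects. Positivity of all their roots keeps
each object from being concentrated at the vertex of the next reflection. -/
theorem reflectedSimple_spec {l : List ι} {Q : ColouredQuiver ι}
    (hQ : IsOrientation S.dynkinGraph Q.arrow) (hl : Q.IsAdapted l) {i : ι}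
    (hpos : ∀ t, t <:+ l → S.IsPositiveRoot (S.wordProd t (S.root i))) :
    (reflectedSimple K Q l hl i).IsIndecomposable ∧
    ∑ j, (reflectedSimple K Q l hl i).dimVec j • S.root j = S.wordProd l (S.root i) ∧
    ∀ j, ((reflectedSimple K Q l hl i).space j).grade (Q.colour j) = ⊤ := by
  classical
  induction l generalizing Q with
  | nil =>
    refine ⟨isIndecomposable_of_dimVec (i := i) fun j => ?_, ?_, grade_simple Q i⟩
    · rw [reflectedSimple, dimVec_simple]
    · simp [reflectedSimple, dimVec_simple]
  | cons k l ih =>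
    obtain ⟨h1, h2, h3⟩ := ih (hQ.reflect k) hl.2 fun t ht => hpos t (ht.trans (l.suffix_cons k))
    have hγ := hpos l (l.suffix_cons k)
    have hγ' := hpos (k :: l) List.suffix_rfl
    rw [S.wordProd_cons] at hγ'
    -- Otherwise the current root is a multiple of `α_k`, and `s_k` makes it negative.
    have hne : ∃ j ≠ k, Nontrivial ((reflectedSimple K (Q.reflect k) l hl.2 i).space j) := by
      by_contra! hall
      have hdim : ∀ j, j ≠ k → (reflectedSimple K (Q.reflect k) l hl.2 i).dimVec j = 0 :=
        fun j hj => by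
          have := hall j hj
          exact Module.finrank_zero_of_subsingleton
      rw [← h2, Finset.sum_eq_single k (fun j _ hj => by rw [hdim j hj, zero_smul]) (by simp),
        map_nsmul, S.simpleReflection_root, smul_neg] at hγ'
      rw [← h2, Finset.sum_eq_single k (fun j _ hj => by rw [hdim j hj, zero_smul]) (by simp)] at hγ
      exact hγ.not_neg hγ'
    have hinj := h1.outMap_injective hl.1
      (SimpleSystem.coeff_le_one (S := S) (h2.symm ▸ hγ.1) k) hne
    refine ⟨h1.superReflection hl.1 hinj hne, ?_, grade_colour_superReflection hl.1 h3⟩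
    rw [S.wordProd_cons, ← h2]
    exact sum_dimVec_superReflection hQ hl.1 hinj

/-- A super-representation with spaces of dimension at most `1`, each of the parity given by the
colour of its vertex, has the parity of its dimension vector. -/
theorem hasParity_rootParity {Q : ColouredQuiver ι} {X : SuperRep.{u, v} K Q}
    (hQ : ∀ i, Q.colour i = rootParity (S.root i))
    (hX : ∀ i, (X.space i).grade (Q.colour i) = ⊤)
    (hα : IsSuperRoot (∑ i, X.dimVec i • S.root i)) :
    X.HasParity (rootParity (∑ i, X.dimVec i • S.root i)) := by
  -- With dimensions `0` or `1`, the product is the colour on the support and `0` at zero spaces, as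
  -- the convention on parity requires.
  refine ⟨fun i => X.dimVec i * Q.colour i, fun i => ?_, fun i h => ?_, ?_⟩
  · have := SimpleSystem.coeff_le_one hα i
    rcases Nat.le_one_iff_eq_zero_or_eq_one.1 this with h | h
    · have := (Module.finrank_zero_iff (R := K) (M := X.space i)).1 h
      exact Subsingleton.elim _ _
    · simp only [h, Nat.cast_one, one_mul, hX]
  · have h0 : X.dimVec i = 0 := Module.finrank_zero_of_subsingleton
    simp [h0]
  · rw [rootParity_eq_parityHom hα, map_sum]
    refine Finset.sum_congr rfl fun i _ => ?_
    change (X.dimVec i : ZMod 2) * Q.colour i = _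
    rw [map_nsmul, hQ, rootParity_eq_parityHom (S.isRoot i), nsmul_eq_mul]

end SuperRep

theorem theorem5p1 {K : Type u} [Field K] {n m : ℕ} {ι : Type} [Fintype ι]
    (S : SimpleSystem n m ι)
    (Ω : ι → ι → Prop) (hΩ : IsOrientation S.dynkinGraph Ω)
    (l : List ι) (hl : S.IsReducedLongest l) (hadapt : (S.quiver Ω).IsAdapted l)
    (α : Fin n ⊕ Fin m → ℤ) (hα : S.IsPositiveRoot α) :
    (∃! j : Fin l.length, S.wordRoot l j = α) ∧
    ∀ j : Fin l.length, S.wordRoot l j = α →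
      (SuperRep.wordObject K (S.quiver Ω) l hadapt j).IsIndecomposable ∧
      ∑ i, (SuperRep.wordObject K (S.quiver Ω) l hadapt j).dimVec i • S.root i = α ∧
      (SuperRep.wordObject K (S.quiver Ω) l hadapt j).HasParity (rootParity α) ∧
      ∀ Y : SuperRep.{u, v} K (S.quiver Ω), Y.IsIndecomposable →
        ∑ i, Y.dimVec i • S.root i = α →
        Y.Isomorphic (SuperRep.wordObject K (S.quiver Ω) l hadapt j) := by
  constructor
  · obtain ⟨j, hj⟩ := hl.exists_wordRoot_eq hα
    exact ⟨j, hj, fun k hk => hl.1.wordRoot_injective (hk.trans hj.symm)⟩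
  intro j hj
  -- A suffix of the first `j` letters followed by the next letter is a factor of the reduced word
  -- `l`, hence itself reduced.
  have hpos : ∀ t, t <:+ l.take j → S.IsPositiveRoot (S.wordProd t (S.root (l.get j))) := by
    rintro t ⟨p, hp⟩
    refine SimpleSystem.IsReduced.isPositiveRoot
      (SimpleSystem.IsReduced.of_append_right (l := p)
        (SimpleSystem.IsReduced.of_append_left (l' := l.drop (j + 1)) ?_))
    rw [← List.append_assoc p, hp]
    simpa using hl.1
  obtain ⟨h1, h2, h3⟩ := SuperRep.reflectedSimple_spec (K := K) (Q := S.quiver Ω) hΩ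
    (hadapt.take j) hpos
  change (SuperRep.wordObject K (S.quiver Ω) l hadapt j).IsIndecomposable at h1
  change ∑ i, (SuperRep.wordObject K (S.quiver Ω) l hadapt j).dimVec i • S.root i =
    S.wordRoot l j at h2
  rw [hj] at h2
  refine ⟨h1, h2, ?_, fun Y hY hYα => ?_⟩
  · have := SuperRep.hasParity_rootParity (S := S) (fun _ => rfl) h3 (h2.symm ▸ hα.1)
    change SuperRep.HasParity _ (rootParity
      (∑ i, (SuperRep.wordObject K (S.quiver Ω) l hadapt j).dimVec i • S.root i)) at this
    rwa [h2] at this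
  · have hdim : Y.dimVec = (SuperRep.wordObject K (S.quiver Ω) l hadapt j).dimVec := by
      have := SimpleSystem.coeff_ext (S := S) (c := fun i => (Y.dimVec i : ℤ))
        (d := fun i => ((SuperRep.wordObject K (S.quiver Ω) l hadapt j).dimVec i : ℤ))
        (by simp only [SimpleSystem.sum_natCast_smul, hYα, h2])
      exact funext fun i => by exact_mod_cast congrFun this i
    exact hY.isomorphic h1 S.position_injective
      (fun i j e => SimpleSystem.dynkinGraph_adj_iff.1 ((hΩ.1 i j).2 (Or.inl e))) hΩ.2 hdim
      (SimpleSystem.coeff_le_one (S := S) (hYα.symm ▸ hα.1))
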